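/- For a finite poset $P$, let $\rho$ be rowmotion on antichains, which sends an antichain $A$ to the set of minimal elements of the complement of the order ideal generated by $A$, and let $\hat\rho$ be rowmotion on (lower) order ideals, which sends an ideal $I$ to the ideal generated by the minimal elements of $P\setminus I$. Both maps are bijections; their orbits are those of the cyclic groups that they generate, and the size of an orbit is the number of its elements. Let $a\ge 2$ and $b\ge 1$ be integers, and let $\breve F(a,b,a)$ be the fence poset with elements $x_1,\dots,x_n$, $n=2a+b-1$, and covering relations $$x_1\lhd x_2\lhd\cdots\lhd x_a\rhd x_{a+1}\rhd\cdots\rhd x_{a+b}\lhd x_{a+b+1}\lhd\cdots\lhd x_{2a+b-1}.$$ Put $g=\gcd(a,b)$, $\bar a=a/g$, $\bar b=b/g$, $\ell=\operatorname{lcm}(a,b)$. There is a smallest positive integer $m$ such that $m\bar a=q\bar b+1$ for some positive integer $q$. With this $m$ the following hold. (a) The orbits of rowmotion on $\breve F(a,b,a)$ (of $\rho$ on antichains and, equally, of $\hat\rho$ on ideals) are partitioned by their size into three (possibly empty) classes $\mathcal S$, $\mathcal M$, $\mathcal L$ such that $$\#\mathcal S=\bar a(g-1)^2,\qquad \#\mathcal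 M=\frac{\bar a m-1}{\bar b},\qquad \#\mathcal L=\frac{\bar a(\bar b-m)+1}{\bar b},$$ where an orbit lies in $\mathcal S$, $\mathcal M$ or $\mathcal L$ if and only if its size is, respectively, $$\ell,\qquad a(2b-2\bar b+m)+g,\qquad a(2b-\bar b+m)+g.$$ (b) The statistic $\chi(A)=\#A$ on antichains is orbomesic for $\rho$: if $\mathcal O_1$, $\mathcal O_2$ are orbits of $\rho$ of the same size, then $\sum_{A\in\mathcal O_1}\#A=\sum_{A\in\mathcal O_2}\#A$. (c) The statistic $\hat\chi(I)=\#I$ on ideals is $n/2$-mesic for $\hat\rho$: for every orbit $\mathcal O$ of $\hat\rho$, $$\frac{1}{\#\mathcal O}\sum_{I\in\mathcal O}\#I=\frac n2 ,\qquad n=\#\breve F(a,b,a)=2a+b-1.$$ -/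

import Mathlib

/-! ### Fences -/

/-- The number of `i` with `1 ≤ i < s` and `α₁ + ⋯ + αᵢ ≤ k`, where `α = (α₁, …, αₛ)`. The shared
elements of the fence of `α` are the `x_j` with `j = α₁ + ⋯ + αᵢ`, `1 ≤ i < s`, so this is the
number of shared elements among `x₁, …, x_k`. -/
def turnsUpTo (α : List ℕ) (k : ℕ) : ℕ :=
  ((Finset.Ico 1 α.length).filter fun i => (α.take i).sum ≤ k).card

/-- The step from `x_k` to `x_{k+1}` goes up: it lies on an odd-numbered segment. -/
def StepUp (α : List ℕ) (k : ℕ) : Prop := Even (turnsUpTo α k)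

/-- The elements `x₁, …, x_n` of the fence of `α = (α₁, …, αₛ)`, where `n = α₁ + ⋯ + αₛ - 1`. -/
def Fence (α : List ℕ) : Type := Fin (α.sum - 1)

namespace Fence

instance (α : List ℕ) : Fintype (Fence α) := inferInstanceAs (Fintype (Fin (α.sum - 1)))

instance (α : List ℕ) : DecidableEq (Fence α) := inferInstanceAs (DecidableEq (Fin (α.sum - 1)))

/-- The index `j ∈ {1, …, n}` of the element `x_j`. -/
def index {α : List ℕ} (x : Fence α) : ℕ := Fin.val x + 1

theorem index_injective {α : List ℕ} : Function.Injective (index (α := α)) :=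
  fun _ _ h => Fin.ext (Nat.succ.inj h)

/-- The fence order: `x_i ⊴ x_j` when every step on the way from `x_i` to `x_j` goes up. (If
`j < i` this means that all steps `x_k`, `x_{k+1}` with `j ≤ k < i` go down.) -/
instance (α : List ℕ) : PartialOrder (Fence α) where
  le x y :=
    (x.index ≤ y.index ∧ ∀ k, x.index ≤ k → k < y.index → StepUp α k) ∨
    (y.index ≤ x.index ∧ ∀ k, y.index ≤ k → k < x.index → ¬ StepUp α k)
  le_refl x := Or.inl ⟨le_rfl, fun k h h' => absurd h' (not_lt.2 h)⟩
  le_trans x y z := by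
    rintro (⟨h1, h2⟩ | ⟨h1, h2⟩) (⟨h3, h4⟩ | ⟨h3, h4⟩)
    · refine Or.inl ⟨h1.trans h3, fun k hk hk' => ?_⟩
      rcases lt_or_ge k y.index with h | h
      · exact h2 k hk h
      · exact h4 k h hk'
    · rcases h1.eq_or_lt with h | h
      · exact Or.inr ⟨h ▸ h3, fun k hk hk' => h4 k hk (h ▸ hk')⟩
      rcases h3.eq_or_lt with h' | h'
      · exact Or.inl ⟨h' ▸ h1, fun k hk hk' => h2 k hk (h' ▸ hk')⟩
      · exact absurd (h2 (y.index - 1) (by omega) (by omega)) (h4 _ (by omega) (by omega))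
    · rcases h1.eq_or_lt with h | h
      · exact Or.inl ⟨h ▸ h3, fun k hk hk' => h4 k (h ▸ hk) hk'⟩
      rcases h3.eq_or_lt with h' | h'
      · exact Or.inr ⟨h' ▸ h1, fun k hk hk' => h2 k (h' ▸ hk) hk'⟩
      · exact absurd (h4 y.index le_rfl h') (h2 _ le_rfl h)
    · refine Or.inr ⟨h3.trans h1, fun k hk hk' => ?_⟩
      rcases lt_or_ge k y.index with h | h
      · exact h4 k hk h
      · exact h2 k h hk'
  le_antisymm x y := by
    rintro (⟨h1, h2⟩ | ⟨h1, h2⟩) (⟨h3, h4⟩ | ⟨h3, h4⟩)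
    · exact index_injective (le_antisymm h1 h3)
    · rcases h1.eq_or_lt with h | h
      · exact index_injective h
      · exact absurd (h2 _ le_rfl h) (h4 _ le_rfl h)
    · rcases h1.eq_or_lt with h | h
      · exact (index_injective h).symm
      · exact absurd (h4 _ le_rfl h) (h2 _ le_rfl h)
    · exact index_injective (le_antisymm h3 h1)

end Fence

/-! ### Rowmotion on a finite poset -/

/-- The antichains of `P`. -/
def Antichains (P : Type*) [LE P] : Type _ := {A : Set P // IsAntichain (· ≤ ·) A}

noncomputable section Rowmotion

variable (P : Type*) [PartialOrder P] [Finite P]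

/-- `Δ`: an ideal goes to its set of maximal elements; inversely, an antichain goes to the ideal
that it generates. -/
def idealEquivAntichain : LowerSet P ≃ Antichains P where
  toFun I := ⟨{x | Maximal (· ∈ I) x}, setOfPred_maximal_antichain _⟩
  invFun A := lowerClosure A.1
  left_inv I := by
    ext x
    simp only [SetLike.mem_coe, mem_lowerClosure, Set.mem_ofPred_eq]
    constructor
    · rintro ⟨y, hy, hxy⟩
      exact I.lower hxy hy.prop
    · intro hx
      obtain ⟨y, hxy, hy⟩ := (Set.toFinite (I : Set P)).exists_le_maximal hx
      exact ⟨y, hy, hxy⟩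
  right_inv A := Subtype.ext (Set.ext fun _ => A.2.maximal_mem_lowerClosure_iff_mem)

/-- `∇`: an upper order ideal goes to its set of minimal elements; inversely, an antichain goes to
the upper order ideal that it generates. -/
def upperEquivAntichain : UpperSet P ≃ Antichains P where
  toFun U := ⟨{x | Minimal (· ∈ U) x}, setOfPred_minimal_antichain _⟩
  invFun A := upperClosure A.1
  left_inv U := by
    ext x
    simp only [SetLike.mem_coe, mem_upperClosure, Set.mem_ofPred_eq]
    constructor
    · rintro ⟨y, hy, hxy⟩
      exact U.upper hxy hy.prop
    · intro hx
      obtain ⟨y, hxy, hy⟩ := (Set.toFinite (U : Set P)).exists_le_minimal hx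
      exact ⟨y, hy, hxy⟩
  right_inv A := Subtype.ext (Set.ext fun _ => A.2.minimal_mem_upperClosure_iff_mem)

/-- Complementation, from ideals to upper order ideals. -/
def idealCompl : LowerSet P ≃ UpperSet P where
  toFun I := I.compl
  invFun U := U.compl
  left_inv I := I.compl_compl
  right_inv U := U.compl_compl

/-- Rowmotion on antichains, `ρ = ∇ ∘ c ∘ Δ⁻¹`. -/
def rowmotion : Equiv.Perm (Antichains P) :=
  ((idealEquivAntichain P).symm.trans (idealCompl P)).trans (upperEquivAntichain P)

/-- Rowmotion on ideals, `ρ̂ = Δ⁻¹ ∘ ∇ ∘ c`. -/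
def idealRowmotion : Equiv.Perm (LowerSet P) :=
  ((idealCompl P).trans (upperEquivAntichain P)).trans (idealEquivAntichain P).symm

variable {P}

/-- `χ(A) = #A`. -/
def antichainCard (A : Antichains P) : ℕ := A.1.ncard

/-- `χ̂(I) = #I`. -/
def idealCard (I : LowerSet P) : ℕ := (I : Set P).ncard

end Rowmotion

/-! ### Orbits and statistics -/

section Orbits

variable {X : Type*}

/-- The orbits of the group generated by the permutation `f`, as subsets of `X`. -/
def orbitsOf (f : Equiv.Perm X) : Set (Set X) :=
  Set.range fun x => MulAction.orbit (Subgroup.zpowers f) x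

/-- The total value of a statistic on an orbit. It is used only for finite `X`. -/
noncomputable def statTotal (st : X → ℕ) (O : Set X) : ℕ := ∑ᶠ x ∈ O, st x

/-- `st` is `d`-mesic: its average over every orbit is `d`. -/
def IsMesic (f : Equiv.Perm X) (st : X → ℕ) (d : ℚ) : Prop :=
  ∀ O ∈ orbitsOf f, (statTotal st O : ℚ) / (O.ncard : ℚ) = d

/-- `st` is orbomesic: its total is the same on any two orbits of the same size. -/
def IsOrbomesic (f : Equiv.Perm X) (st : X → ℕ) : Prop :=
  ∀ O₁ ∈ orbitsOf f, ∀ O₂ ∈ orbitsOf f, O₁.ncard = O₂.ncard → statTotal st O₁ = statTotal st O₂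

/-- The orbits of `f` are partitioned by length into three (possibly empty) classes: `c₁` orbits of
size `s₁`, `c₂` orbits of size `s₂` and `c₃` orbits of size `s₃`. -/
def OrbitsPartitionByLength (f : Equiv.Perm X) (c₁ s₁ c₂ s₂ c₃ s₃ : ℚ) : Prop :=
  ∃ S M L : Set (Set X),
    S ∪ M ∪ L = orbitsOf f ∧ Disjoint S M ∧ Disjoint S L ∧ Disjoint M L ∧
    (S.ncard : ℚ) = c₁ ∧ (M.ncard : ℚ) = c₂ ∧ (L.ncard : ℚ) = c₃ ∧
    ∀ O ∈ orbitsOf f,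
      (O ∈ S ↔ (O.ncard : ℚ) = s₁) ∧ (O ∈ M ↔ (O.ncard : ℚ) = s₂) ∧ (O ∈ L ↔ (O.ncard : ℚ) = s₃)

end Orbits

/-!
An ideal of the fence `F(a, b, a)` is given by the numbers of its elements on the three segments and
by whether it contains the peak `x_a` and the valley `x_{a+b}`. In these coordinates (`FenceState`)
rowmotion is a system of three cyclic counters modulo `a`, `b`, `a` that advance by one in each step
(`FenceState.step`), with two kinds of pauses: the first two counters pause for one step when they
are about to return to `0` together (then the ideal contains the peak), and the last two pause when
they have just returned to `0` together (then the ideal misses the valley).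

Let `g = gcd a b`. If no two neighbouring counters ever return together, the orbit has size
`lcm a b`. The other orbits are determined by their pauses. `peak k` is followed by the pause
`peak (k + 1)` after `lcm a b + 1` steps, unless `g ∣ k + 1`; in that case `k = -1 - b c` for a unique
`0 ≤ c < a / g`, and the next pause is `noValley (b c)`, after `b c + 1` steps. Symmetrically
`noValley i` is followed by `noValley (i + 1)`, unless `i = -1 - b d` with `1 ≤ d ≤ a / g`, and then
by `peak (b d)` after `b d + 1` steps. So an orbit with pauses meets exactly
`peak (b d), …, peak (b d + g - 1), noValley (b c), …, noValley (b c + g - 1)`, where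
`b (c + d) ≡ -g` modulo `a`, and its size is `2 (g - 1) (lcm a b + 1) + b (c + d) + 2`
(`FenceState.orbit_peak`). If `m (a / g) = q (b / g) + 1`, the congruence says that `c + d = q`, which
happens for `d ≤ q`, or `c + d = q + a / g`, for `d > q`. This gives two classes with `q` and
`a / g - q` orbits. The number of orbits of size `lcm a b` follows by counting all ideals
(`FenceState.BezoutData.orbitsPartitionByLength`).

Both statistics are, up to a coboundary `u ∘ step - u`, a constant plus a constant multiple of the
indicator of each kind of pause (`FenceState.idealSize_eq`, `FenceState.antichainSize_eq`), so the
total on an orbit depends only on its size and its numbers of pauses. An orbit has either none or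
`g` of each kind, and its size tells which (`FenceState.BezoutData.ncard_inter`). For the size of an
ideal the two kinds contribute with opposite signs and cancel.
-/

/-! ### The fence `F(a, b, a)` in coordinates -/

theorem ZMod.eq_neg_one_iff_val {n : ℕ} [NeZero n] (x : ZMod n) : x = -1 ↔ x.val + 1 = n := by
  have hx := x.val_lt
  rw [eq_neg_iff_add_eq_zero, ← ZMod.natCast_zmod_val x]
  norm_cast
  rw [ZMod.natCast_eq_zero_iff, ZMod.val_natCast, Nat.mod_eq_of_lt hx]
  constructor
  · intro h
    exact le_antisymm hx (Nat.le_of_dvd (by omega) h)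
  · intro h
    rw [h]

theorem ZMod.val_add_one_eq {n : ℕ} [NeZero n] (x : ZMod n) :
    (x + 1).val = if x = -1 then 0 else x.val + 1 := by
  have hx := x.val_lt
  split_ifs with h
  · simp [h]
  · rw [ZMod.eq_neg_one_iff_val] at h
    have : x + 1 = ((x.val + 1 : ℕ) : ZMod n) := by simp
    rw [this, ZMod.val_natCast, Nat.mod_eq_of_lt (by omega)]

namespace Fence

variable {a b : ℕ}

theorem stepUp_iff (hb : 1 ≤ b) (k : ℕ) : StepUp [a, b, a] k ↔ k < a ∨ a + b ≤ k := by
  have h : Finset.Ico 1 [a, b, a].length = {1, 2} := rfl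
  unfold StepUp turnsUpTo
  rw [h, Finset.filter_insert, Finset.filter_singleton]
  by_cases h1 : a ≤ k <;> by_cases h2 : a + b ≤ k <;> simp [h1, h2] <;> omega

theorem index_pos (x : Fence [a, b, a]) : 1 ≤ x.index := Nat.succ_pos _

theorem index_le (x : Fence [a, b, a]) : x.index ≤ 2 * a + b - 1 := by
  have h : Fin.val x < [a, b, a].sum - 1 := Fin.isLt x
  simp only [List.sum_cons, List.sum_nil] at h
  unfold index
  omega

theorem exists_index_eq {n : ℕ} (h1 : 1 ≤ n) (h2 : n ≤ 2 * a + b - 1) :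
    ∃ x : Fence [a, b, a], x.index = n := by
  refine ⟨(⟨n - 1, ?_⟩ : Fin ([a, b, a].sum - 1)), ?_⟩
  · simp only [List.sum_cons, List.sum_nil]
    omega
  · unfold index
    simp only
    omega

theorem le_iff (hb : 1 ≤ b) (x y : Fence [a, b, a]) : x ≤ y ↔
    (x.index ≤ y.index ∧ (y.index ≤ a ∨ a + b ≤ x.index ∨ x.index = y.index)) ∨
    (y.index ≤ x.index ∧ a ≤ y.index ∧ x.index ≤ a + b) ∨ x.index = y.index := by
  change ((x.index ≤ y.index ∧ ∀ k, x.index ≤ k → k < y.index → StepUp [a, b, a] k) ∨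
    (y.index ≤ x.index ∧ ∀ k, y.index ≤ k → k < x.index → ¬ StepUp [a, b, a] k)) ↔ _
  simp only [stepUp_iff hb]
  constructor
  · rintro (⟨h, h'⟩ | ⟨h, h'⟩)
    · have h1 := h' x.index
      have h2 := h' a
      have h3 := h' (y.index - 1)
      omega
    · have h1 := h' y.index
      have h3 := h' (x.index - 1)
      omega
  · intro h
    rcases le_or_gt x.index y.index with h1 | h1
    · rcases h1.eq_or_lt with h2 | h2
      · exact Or.inl ⟨h1, fun k _ _ => by omega⟩
      · exact Or.inl ⟨h1, fun k _ _ => by omega⟩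
    · exact Or.inr ⟨h1.le, fun k _ _ => by omega⟩

/-- Minimality in the complement of an ideal only has to be tested on the elements covered. -/
theorem minimal_notMem_iff (ha : 1 ≤ a) (hb : 1 ≤ b) (I : LowerSet (Fence [a, b, a]))
    (Q : ℕ → Prop) (hQ : ∀ x : Fence [a, b, a], x ∈ I ↔ Q x.index) (y : Fence [a, b, a]) :
    Minimal (· ∉ I) y ↔ ¬ Q y.index ∧ (2 ≤ y.index → y.index ≤ a → Q (y.index - 1)) ∧
      (a ≤ y.index → y.index < a + b → Q (y.index + 1)) ∧
      (a + b < y.index → Q (y.index - 1)) := by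
  have h1 := y.index_pos
  have h2 := y.index_le
  constructor
  · rintro ⟨h, h'⟩
    rw [hQ] at h
    have key : ∀ n, 1 ≤ n → n ≤ 2 * a + b - 1 → n ≠ y.index →
        (n ≤ y.index ∧ (y.index ≤ a ∨ a + b ≤ n) ∨ y.index ≤ n ∧ a ≤ y.index ∧ n ≤ a + b) →
        Q n := by
      intro n hn1 hn2 hne hn
      obtain ⟨z, rfl⟩ := exists_index_eq hn1 hn2
      by_contra hz
      have hzy : z ≤ y := (le_iff hb z y).2 (by omega)
      have := h' (y := z) (mt (hQ z).1 hz) hzy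
      exact hne (congrArg index (le_antisymm hzy this))
    exact ⟨h,
      fun _ _ => key (y.index - 1) (by omega) (by omega) (by omega) (by omega),
      fun _ _ => key (y.index + 1) (by omega) (by omega) (by omega) (by omega),
      fun _ => key (y.index - 1) (by omega) (by omega) (by omega) (by omega)⟩
  · rintro ⟨h, hl, hm, hr⟩
    refine ⟨mt (hQ y).1 h, fun z hz hzy => ?_⟩
    by_contra hyz
    have hlt : z < y := lt_of_le_not_ge hzy hyz
    -- An element `w` covered by `y` lies between `z` and `y`, and it belongs to the ideal.
    have key : ∀ n, 1 ≤ n → n ≤ 2 * a + b - 1 → Q n →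
        ((z.index ≤ n ∧ (n ≤ a ∨ a + b ≤ z.index)) ∨ (n ≤ z.index ∧ a ≤ n ∧ z.index ≤ a + b)) →
        False := by
      intro n hn1 hn2 hn hzn
      obtain ⟨w, rfl⟩ := exists_index_eq hn1 hn2
      exact hz (I.lower ((le_iff hb z w).2 (by omega)) ((hQ w).2 hn))
    have hz1 := z.index_pos
    have hz2 := z.index_le
    have hne : z.index ≠ y.index := fun h => hlt.ne (index_injective h)
    rw [le_iff hb] at hzy
    rcases hzy with ⟨hzy, h3⟩ | ⟨hzy, h3⟩ | h3
    · rcases h3 with h3 | h3 | h3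
      · exact key _ (by omega) (by omega) (hl (by omega) h3) (by omega)
      · exact key _ (by omega) (by omega) (hr (by omega)) (by omega)
      · exact hne h3
    · exact key _ (by omega) (by omega) (hm (by omega) (by omega)) (by omega)
    · exact hne h3

end Fence

/-- Coordinates for the ideals of the fence `F(a, b, a)`: `mid i j k` is the ideal that contains the
valley `x_{a+b}` but not the peak `x_a`, and that has `i`, `j`, `k` further elements on the first,
second and third segment; `peak k` contains `x₁, …, x_{a+b}` and `k` further elements; `noValley i`
consists of `x₁, …, x_i`. Here `i`, `j`, `k` stand for their representatives `ZMod.val`. -/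
inductive FenceState (a b : ℕ) : Type
  | mid (i : ZMod a) (j : ZMod b) (k : ZMod a)
  | peak (k : ZMod a)
  | noValley (i : ZMod a)

namespace FenceState

variable {a b : ℕ}

/-- The element `x_n` belongs to the ideal with the given coordinates. -/
def Mem : FenceState a b → ℕ → Prop
  | mid i j k, n => n ≤ i.val ∨ (a + b ≤ n + j.val ∧ n ≤ a + b + k.val)
  | peak k, n => n ≤ a + b + k.val
  | noValley i, n => n ≤ i.val

/-- Rowmotion in coordinates. All three coordinates advance by one, cyclically, except that the
first two pause for one step (in the state `peak`) when they are about to return to `0` together,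
and the last two pause for one step (in the state `noValley`) when they have just done so. -/
def step : FenceState a b → FenceState a b
  | mid i j k =>
    if i = -1 ∧ j = -1 then peak (k + 1)
    else if j = -1 ∧ k = -1 then noValley (i + 1)
    else mid (i + 1) (j + 1) (k + 1)
  | peak k => if k = -1 then noValley 0 else mid 0 0 (k + 1)
  | noValley i => mid (i + 1) 0 0

variable [NeZero a] [NeZero b]

/-- The ideal with the given coordinates. -/
def toIdeal (s : FenceState a b) : LowerSet (Fence [a, b, a]) where
  carrier := {x | s.Mem x.index}
  lower' := by
    intro y x hxy hy
    have hb : 1 ≤ b := NeZero.one_le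
    rw [Fence.le_iff hb] at hxy
    have hx := x.index_pos
    rcases s with ⟨i, j, k⟩ | k | i
    · have := i.val_lt
      have := j.val_lt
      have := k.val_lt
      simp only [Mem, Set.mem_ofPred_eq] at hy ⊢
      omega
    · simp only [Mem, Set.mem_ofPred_eq] at hy ⊢
      omega
    · have := i.val_lt
      simp only [Mem, Set.mem_ofPred_eq] at hy ⊢
      omega

theorem mem_toIdeal (s : FenceState a b) (x : Fence [a, b, a]) :
    x ∈ s.toIdeal ↔ s.Mem x.index := Iff.rfl

end FenceState

theorem mem_idealRowmotion_iff {P : Type*} [PartialOrder P] [Finite P] (I : LowerSet P) (x : P) :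
    x ∈ idealRowmotion P I ↔ ∃ y, Minimal (· ∉ I) y ∧ x ≤ y := Iff.rfl

namespace FenceState

variable {a b : ℕ} [NeZero a] [NeZero b]

/-- Rowmotion on ideals becomes `step` in coordinates. -/
theorem idealRowmotion_toIdeal (s : FenceState a b) :
    idealRowmotion (Fence [a, b, a]) s.toIdeal = s.step.toIdeal := by
  have ha : 1 ≤ a := NeZero.one_le
  have hb : 1 ≤ b := NeZero.one_le
  ext x
  rw [SetLike.mem_coe, SetLike.mem_coe, mem_idealRowmotion_iff, mem_toIdeal]
  simp only [Fence.minimal_notMem_iff ha hb _ _ s.mem_toIdeal, Fence.le_iff hb]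
  have hx1 := x.index_pos
  have hx2 := x.index_le
  generalize x.index = n at *
  constructor
  · rintro ⟨y, hy, hxy⟩
    have hy1 := y.index_pos
    have hy2 := y.index_le
    generalize y.index = r at *
    rcases s with ⟨i, j, k⟩ | k | i
    · have := i.val_lt
      have := j.val_lt
      have := k.val_lt
      simp only [Mem, step] at hy ⊢
      simp only [ZMod.eq_neg_one_iff_val]
      split_ifs <;> simp only [ZMod.val_add_one_eq, ZMod.eq_neg_one_iff_val] <;>
        split_ifs <;> omega
    · have := k.val_lt
      simp only [Mem, step] at hy ⊢
      simp only [ZMod.eq_neg_one_iff_val]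
      split_ifs <;> simp only [ZMod.val_add_one_eq, ZMod.eq_neg_one_iff_val, ZMod.val_zero] <;>
        (try split_ifs) <;> omega
    · have := i.val_lt
      simp only [Mem, step] at hy ⊢
      simp only [ZMod.val_add_one_eq, ZMod.eq_neg_one_iff_val, ZMod.val_zero]
      split_ifs <;> omega
  · intro h
    suffices H : ∃ r, 1 ≤ r ∧ r ≤ 2 * a + b - 1 ∧ (¬ s.Mem r ∧ (2 ≤ r → r ≤ a → s.Mem (r - 1)) ∧
        (a ≤ r → r < a + b → s.Mem (r + 1)) ∧ (a + b < r → s.Mem (r - 1))) ∧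
        ((n ≤ r ∧ (r ≤ a ∨ a + b ≤ n ∨ n = r)) ∨ (r ≤ n ∧ a ≤ r ∧ n ≤ a + b) ∨ n = r) by
      obtain ⟨r, h1, h2, h3, h4⟩ := H
      obtain ⟨y, rfl⟩ := Fence.exists_index_eq h1 h2
      exact ⟨y, h3, h4⟩
    rcases s with ⟨i, j, k⟩ | k | i
    · have := i.val_lt
      have := j.val_lt
      have := k.val_lt
      simp only [step] at h
      simp only [ZMod.eq_neg_one_iff_val] at h
      split_ifs at h with h1 h2 <;>
        simp only [Mem, ZMod.val_add_one_eq, ZMod.eq_neg_one_iff_val] at h ⊢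
      · rcases le_or_gt n (a + b) with hn | hn
        · exact ⟨a, by omega⟩
        · exact ⟨a + b + k.val + 1, by split_ifs at h <;> omega⟩
      · exact ⟨i.val + 1, by split_ifs at h <;> omega⟩
      · rcases lt_or_ge n a with hn | hn
        · exact ⟨i.val + 1, by split_ifs at h <;> omega⟩
        · rcases lt_or_ge n (a + b) with hn | hn
          · exact ⟨a + b - j.val - 1, by split_ifs at h <;> omega⟩
          · by_cases hk : k.val + 1 = a
            · exact ⟨a + b - j.val - 1, by split_ifs at h <;> omega⟩
            · exact ⟨a + b + k.val + 1, by split_ifs at h <;> omega⟩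
    · have := k.val_lt
      simp only [step] at h
      simp only [ZMod.eq_neg_one_iff_val] at h
      split_ifs at h
      all_goals
        simp only [Mem, ZMod.val_add_one_eq, ZMod.eq_neg_one_iff_val, ZMod.val_zero] at h ⊢
      · omega
      · exact ⟨a + b + k.val + 1, by split_ifs at h; omega⟩
    · have := i.val_lt
      simp only [step] at h
      simp only [Mem, ZMod.val_add_one_eq, ZMod.eq_neg_one_iff_val, ZMod.val_zero] at h ⊢
      rcases lt_or_ge n a with hn | hn
      · exact ⟨i.val + 1, by split_ifs at h <;> omega⟩
      · exact ⟨a + b, by split_ifs at h <;> omega⟩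

end FenceState

/-! ### All ideals have coordinates; their sizes -/

/-- A set of integers in `[1, N]` that is closed downwards is an initial segment. -/
theorem Nat.exists_threshold (p : ℕ → Prop) (N : ℕ)
    (h : ∀ n, 1 ≤ n → n + 1 ≤ N → p (n + 1) → p n) :
    ∃ i ≤ N, ∀ n, 1 ≤ n → n ≤ N → (p n ↔ n ≤ i) := by
  induction N with
  | zero => exact ⟨0, le_rfl, fun n h1 h2 => by omega⟩
  | succ N ih =>
    obtain ⟨i, hi, hp⟩ := ih fun n h1 h2 => h n h1 (by omega)
    by_cases hN : p (N + 1)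
    · have hiN : i = N := by
        by_contra hne
        have h1 := (hp N (by omega) le_rfl).1 (h N (by omega) le_rfl hN)
        omega
      refine ⟨N + 1, le_rfl, fun n h1 h2 => ⟨fun _ => h2, fun _ => ?_⟩⟩
      rcases h2.eq_or_lt with rfl | h3
      · exact hN
      · exact (hp n h1 (by omega)).2 (by omega)
    · refine ⟨i, by omega, fun n h1 h2 => ?_⟩
      rcases h2.eq_or_lt with rfl | h3
      · exact ⟨fun h => absurd h hN, fun h => by omega⟩
      · exact hp n h1 (by omega)

theorem Fence.ncard_index_mem {a b : ℕ} (F : Finset ℕ) (hF : ∀ n ∈ F, 1 ≤ n ∧ n ≤ 2 * a + b - 1) :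
    {x : Fence [a, b, a] | x.index ∈ F}.ncard = F.card := by
  rw [← Set.ncard_coe_finset, ← Set.ncard_image_of_injective _ Fence.index_injective]
  congr 1
  ext n
  constructor
  · rintro ⟨x, hx, rfl⟩
    exact hx
  · intro hn
    obtain ⟨x, rfl⟩ := Fence.exists_index_eq (hF n hn).1 (hF n hn).2
    exact ⟨x, hn, rfl⟩

theorem Finset.mem_ite_empty_singleton {p : Prop} [Decidable p] {m n : ℕ} :
    n ∈ (if p then (∅ : Finset ℕ) else {m}) ↔ ¬ p ∧ n = m := by
  split_ifs with h <;> simp [h]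

theorem Finset.mem_ite_singleton_empty {p : Prop} [Decidable p] {m n : ℕ} :
    n ∈ (if p then ({m} : Finset ℕ) else ∅) ↔ p ∧ n = m := by
  split_ifs with h <;> simp [h]

namespace FenceState

variable {a b : ℕ} [NeZero a] [NeZero b]

theorem toIdeal_injective : Function.Injective (toIdeal (a := a) (b := b)) := by
  have ha : 1 ≤ a := NeZero.one_le
  have hb : 1 ≤ b := NeZero.one_le
  intro s t hst
  have key : ∀ n, 1 ≤ n → n ≤ 2 * a + b - 1 → (s.Mem n ↔ t.Mem n) := by
    intro n h1 h2
    obtain ⟨x, rfl⟩ := Fence.exists_index_eq h1 h2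
    rw [← mem_toIdeal, ← mem_toIdeal, hst]
  have hpeak := key a
  have hvalley := key (a + b)
  rcases s with ⟨i, j, k⟩ | k | i <;> rcases t with ⟨i', j', k'⟩ | k' | i'
  · have := i.val_lt
    have := j.val_lt
    have := k.val_lt
    have := i'.val_lt
    have := j'.val_lt
    have := k'.val_lt
    have h1 := key i.val
    have h2 := key i'.val
    have h3 := key (a + b - j.val)
    have h4 := key (a + b - j'.val)
    have h5 := key (a + b + k.val)
    have h6 := key (a + b + k'.val)
    simp only [Mem] at h1 h2 h3 h4 h5 h6
    have hi : i.val = i'.val := by omega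
    have hj : j.val = j'.val := by omega
    have hk : k.val = k'.val := by omega
    rw [ZMod.val_injective _ hi, ZMod.val_injective _ hj, ZMod.val_injective _ hk]
  · have := i.val_lt
    have := j.val_lt
    simp only [Mem] at hpeak
    omega
  · have := i'.val_lt
    simp only [Mem] at hvalley
    omega
  · have := i'.val_lt
    have := j'.val_lt
    simp only [Mem] at hpeak
    omega
  · have := k.val_lt
    have := k'.val_lt
    have h5 := key (a + b + k.val)
    have h6 := key (a + b + k'.val)
    simp only [Mem] at h5 h6
    have hk : k.val = k'.val := by omega
    rw [ZMod.val_injective _ hk]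
  · have := i'.val_lt
    simp only [Mem] at hvalley
    omega
  · have := i.val_lt
    simp only [Mem] at hvalley
    omega
  · have := i.val_lt
    simp only [Mem] at hvalley
    omega
  · have := i.val_lt
    have := i'.val_lt
    have h1 := key i.val
    have h2 := key i'.val
    simp only [Mem] at h1 h2
    have hi : i.val = i'.val := by omega
    rw [ZMod.val_injective _ hi]

theorem toIdeal_surjective : Function.Surjective (toIdeal (a := a) (b := b)) := by
  have ha : 1 ≤ a := NeZero.one_le
  have hb : 1 ≤ b := NeZero.one_le
  intro I
  let Q : ℕ → Prop := fun n => ∃ x ∈ I, x.index = n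
  have hQ : ∀ x : Fence [a, b, a], x ∈ I ↔ Q x.index := fun x =>
    ⟨fun h => ⟨x, h, rfl⟩, fun ⟨y, hy, h⟩ => Fence.index_injective h ▸ hy⟩
  have lower : ∀ m n, 1 ≤ m → m ≤ 2 * a + b - 1 →
      ((m ≤ n ∧ (n ≤ a ∨ a + b ≤ m)) ∨ (n ≤ m ∧ a ≤ n ∧ m ≤ a + b)) → Q n → Q m := by
    rintro m n h1 h2 h3 ⟨x, hx, rfl⟩
    obtain ⟨y, rfl⟩ := Fence.exists_index_eq h1 h2
    exact ⟨y, I.lower ((Fence.le_iff hb y x).2 (by omega)) hx, rfl⟩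
  obtain ⟨i, hi, hQi⟩ := Nat.exists_threshold Q (a - 1) fun n h1 h2 =>
    lower n (n + 1) h1 (by omega) (by omega)
  obtain ⟨j, hj, hQj⟩ := Nat.exists_threshold (fun m => Q (a + b - m)) (b - 1) fun n h1 h2 =>
    lower _ _ (by omega) (by omega) (by omega)
  obtain ⟨k, hk, hQk⟩ := Nat.exists_threshold (fun m => Q (a + b + m)) (a - 1) fun n h1 h2 =>
    lower _ _ (by omega) (by omega) (by omega)
  have vi : (i : ZMod a).val = i := ZMod.val_cast_of_lt (by omega)
  have vj : (j : ZMod b).val = j := ZMod.val_cast_of_lt (by omega)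
  have vk : (k : ZMod a).val = k := ZMod.val_cast_of_lt (by omega)
  suffices H : ∃ s : FenceState a b, ∀ n, 1 ≤ n → n ≤ 2 * a + b - 1 → (s.Mem n ↔ Q n) by
    obtain ⟨s, hs⟩ := H
    refine ⟨s, ?_⟩
    ext x
    rw [SetLike.mem_coe, SetLike.mem_coe, mem_toIdeal, hQ, hs _ x.index_pos x.index_le]
  by_cases hpeak : Q a
  · refine ⟨peak (k : ZMod a), fun n h1 h2 => ?_⟩
    simp only [Mem, vk]
    rcases le_or_gt n (a + b) with hn | hn
    · exact iff_of_true (by omega) (lower n a h1 h2 (by omega) hpeak)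
    · have := hQk (n - (a + b)) (by omega) (by omega)
      rw [show a + b + (n - (a + b)) = n by omega] at this
      rw [this]
      omega
  · have hleft : ∀ n, 1 ≤ n → n ≤ a → (Q n ↔ n ≤ i) := by
      intro n h1 h2
      rcases h2.eq_or_lt with rfl | h2
      · exact iff_of_false hpeak (by omega)
      · exact hQi n h1 (by omega)
    by_cases hvalley : Q (a + b)
    · refine ⟨mid (i : ZMod a) (j : ZMod b) (k : ZMod a), fun n h1 h2 => ?_⟩
      simp only [Mem, vi, vj, vk]
      rcases le_or_gt n a with hn | hn
      · rw [hleft n h1 hn]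
        omega
      · rcases lt_trichotomy n (a + b) with hn' | rfl | hn'
        · have := hQj (a + b - n) (by omega) (by omega)
          rw [show a + b - (a + b - n) = n by omega] at this
          rw [this]
          omega
        · exact iff_of_true (by omega) hvalley
        · have := hQk (n - (a + b)) (by omega) (by omega)
          rw [show a + b + (n - (a + b)) = n by omega] at this
          rw [this]
          omega
    · refine ⟨noValley (i : ZMod a), fun n h1 h2 => ?_⟩
      simp only [Mem, vi]
      rcases le_or_gt n a with hn | hn
      · rw [hleft n h1 hn]
      · refine iff_of_false (by omega) fun h => hvalley (lower (a + b) n ?_ ?_ ?_ h) <;> omega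

variable (a b) in
/-- The ideals of the fence `F(a, b, a)` correspond to their coordinates. -/
noncomputable def equivIdeal : FenceState a b ≃ LowerSet (Fence [a, b, a]) :=
  Equiv.ofBijective toIdeal ⟨toIdeal_injective, toIdeal_surjective⟩

variable (a b) in
/-- Rowmotion in coordinates, as a permutation. -/
noncomputable def stepPerm : Equiv.Perm (FenceState a b) :=
  ((equivIdeal a b).trans (idealRowmotion _)).trans (equivIdeal a b).symm

theorem stepPerm_apply (s : FenceState a b) : stepPerm a b s = s.step := by
  change (equivIdeal a b).symm (idealRowmotion _ s.toIdeal) = _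
  rw [idealRowmotion_toIdeal]
  exact (equivIdeal a b).symm_apply_apply _

/-- The number of elements of the ideal with the given coordinates. -/
def idealSize : FenceState a b → ℕ
  | mid i j k => i.val + j.val + k.val + 1
  | peak k => a + b + k.val
  | noValley i => i.val

theorem idealCard_toIdeal (s : FenceState a b) : idealCard s.toIdeal = s.idealSize := by
  have ha : 1 ≤ a := NeZero.one_le
  have hb : 1 ≤ b := NeZero.one_le
  change {x : Fence [a, b, a] | s.Mem x.index}.ncard = _
  suffices H : ∃ F : Finset ℕ, (∀ n ∈ F, 1 ≤ n ∧ n ≤ 2 * a + b - 1) ∧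
      (∀ n, 1 ≤ n → (s.Mem n ↔ n ∈ F)) ∧ F.card = s.idealSize by
    obtain ⟨F, hF, hs, hc⟩ := H
    rw [← hc, ← Fence.ncard_index_mem F hF]
    congr 1
    ext x
    exact hs _ x.index_pos
  rcases s with ⟨i, j, k⟩ | k | i
  · have := i.val_lt
    have := j.val_lt
    have := k.val_lt
    refine ⟨Finset.Icc 1 i.val ∪ Finset.Icc (a + b - j.val) (a + b + k.val), ?_, ?_, ?_⟩
    · intro n hn
      simp only [Finset.mem_union, Finset.mem_Icc] at hn
      omega
    · intro n hn
      simp only [Finset.mem_union, Finset.mem_Icc, Mem]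
      omega
    · rw [Finset.card_union_of_disjoint, Nat.card_Icc, Nat.card_Icc]
      · simp only [idealSize]
        omega
      · rw [Finset.disjoint_left]
        intro n h1 h2
        simp only [Finset.mem_Icc] at h1 h2
        omega
  · have := k.val_lt
    refine ⟨Finset.Icc 1 (a + b + k.val), ?_, ?_, ?_⟩
    · intro n hn
      rw [Finset.mem_Icc] at hn
      omega
    · intro n hn
      simp only [Finset.mem_Icc, Mem]
      omega
    · simp [idealSize]
  · have := i.val_lt
    refine ⟨Finset.Icc 1 i.val, ?_, ?_, ?_⟩
    · intro n hn
      rw [Finset.mem_Icc] at hn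
      omega
    · intro n hn
      simp only [Finset.mem_Icc, Mem]
      omega
    · simp [idealSize]

/-- The number of minimal elements of the complement of the ideal with the given coordinates. -/
def antichainSize : FenceState a b → ℕ
  | mid i j k => (if i = -1 then 0 else 1) + (if j = -1 then 0 else 1) + (if k = -1 then 0 else 1)
      + (if i = -1 ∧ j = -1 then 1 else 0)
  | peak k => if k = -1 then 0 else 1
  | noValley i => (if i = -1 then 0 else 1) + 1

/-- The antichain that is taken as the partner of an ideal `I` here consists of the minimal elements
of the complement, that is, of the maximal elements of the image of `I` under rowmotion. -/
theorem antichainCard_minimal_compl (s : FenceState a b) :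
    antichainCard (((idealCompl _).trans (upperEquivAntichain _)) s.toIdeal) = s.antichainSize := by
  have ha : 1 ≤ a := NeZero.one_le
  have hb : 1 ≤ b := NeZero.one_le
  change {x : Fence [a, b, a] | Minimal (· ∉ s.toIdeal) x}.ncard = _
  simp only [Fence.minimal_notMem_iff ha hb _ _ s.mem_toIdeal]
  suffices H : ∃ F : Finset ℕ, (∀ n ∈ F, 1 ≤ n ∧ n ≤ 2 * a + b - 1) ∧
      (∀ n, 1 ≤ n → n ≤ 2 * a + b - 1 → ((¬ s.Mem n ∧ (2 ≤ n → n ≤ a → s.Mem (n - 1)) ∧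
        (a ≤ n → n < a + b → s.Mem (n + 1)) ∧ (a + b < n → s.Mem (n - 1))) ↔ n ∈ F)) ∧
      F.card = s.antichainSize by
    obtain ⟨F, hF, hs, hc⟩ := H
    rw [← hc, ← Fence.ncard_index_mem F hF]
    congr 1
    ext x
    exact hs _ x.index_pos x.index_le
  rcases s with ⟨i, j, k⟩ | k | i
  · have := i.val_lt
    have := j.val_lt
    have := k.val_lt
    refine ⟨(if i = -1 then ∅ else {i.val + 1}) ∪ (if j = -1 then ∅ else {a + b - j.val - 1}) ∪
      (if k = -1 then ∅ else {a + b + k.val + 1}) ∪ (if i = -1 ∧ j = -1 then {a} else ∅),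
      ?_, ?_, ?_⟩
    · intro n hn
      simp only [Finset.mem_union, Finset.mem_ite_empty_singleton, Finset.mem_ite_singleton_empty,
        ZMod.eq_neg_one_iff_val] at hn
      omega
    · intro n hn hn'
      simp only [Finset.mem_union, Finset.mem_ite_empty_singleton, Finset.mem_ite_singleton_empty,
        Mem, ZMod.eq_neg_one_iff_val]
      omega
    · rw [Finset.card_union_of_disjoint, Finset.card_union_of_disjoint,
        Finset.card_union_of_disjoint]
      · simp only [antichainSize]
        split_ifs <;> simp_all
      all_goals
        rw [Finset.disjoint_left]
        intro n h1 h2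
        simp only [Finset.mem_union, Finset.mem_ite_empty_singleton, Finset.mem_ite_singleton_empty,
          ZMod.eq_neg_one_iff_val] at h1 h2
        omega
  · have := k.val_lt
    refine ⟨if k = -1 then ∅ else {a + b + k.val + 1}, ?_, ?_, ?_⟩
    · intro n hn
      simp only [Finset.mem_ite_empty_singleton, ZMod.eq_neg_one_iff_val] at hn
      omega
    · intro n hn hn'
      simp only [Finset.mem_ite_empty_singleton, Mem, ZMod.eq_neg_one_iff_val]
      omega
    · simp only [antichainSize]
      split_ifs <;> simp
  · have := i.val_lt
    refine ⟨(if i = -1 then ∅ else {i.val + 1}) ∪ {a + b}, ?_, ?_, ?_⟩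
    · intro n hn
      simp only [Finset.mem_union, Finset.mem_ite_empty_singleton, Finset.mem_singleton,
        ZMod.eq_neg_one_iff_val] at hn
      omega
    · intro n hn hn'
      simp only [Finset.mem_union, Finset.mem_ite_empty_singleton, Finset.mem_singleton, Mem,
        ZMod.eq_neg_one_iff_val]
      omega
    · rw [Finset.card_union_of_disjoint]
      · simp only [antichainSize]
        split_ifs <;> simp
      · rw [Finset.disjoint_left]
        intro n h1 h2
        simp only [Finset.mem_ite_empty_singleton, Finset.mem_singleton,
          ZMod.eq_neg_one_iff_val] at h1 h2
        omega

omit [NeZero a] [NeZero b] in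
theorem natCard_fence (ha : 1 ≤ a) : Nat.card (Fence [a, b, a]) = 2 * a + b - 1 := by
  change Nat.card (Fin ([a, b, a].sum - 1)) = _
  simp only [List.sum_cons, List.sum_nil, Nat.card_eq_fintype_card, Fintype.card_fin]
  omega

end FenceState

/-! ### Orbits of a permutation -/

section OrbitLemmas

variable {X Y : Type*}

/-- The orbit of `x` under the group generated by `f`. -/
def orbitOf (f : Equiv.Perm X) (x : X) : Set X := MulAction.orbit (Subgroup.zpowers f) x

theorem mem_orbitsOf {f : Equiv.Perm X} {O : Set X} : O ∈ orbitsOf f ↔ ∃ x, orbitOf f x = O :=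
  Iff.rfl

theorem mem_orbitOf_self (f : Equiv.Perm X) (x : X) : x ∈ orbitOf f x := MulAction.mem_orbit_self x

theorem orbitOf_eq_of_mem {f : Equiv.Perm X} {x y : X} (h : y ∈ orbitOf f x) :
    orbitOf f y = orbitOf f x := MulAction.orbit_eq_iff.2 h

theorem mem_orbitOf_iff [Finite X] {f : Equiv.Perm X} {x y : X} :
    y ∈ orbitOf f x ↔ ∃ n : ℕ, f^[n] x = y := by
  constructor
  · rintro ⟨⟨_, k, rfl⟩, h⟩
    have h' : f.SameCycle x y := ⟨k, h⟩
    obtain ⟨n, hn⟩ := h'.exists_nat_pow_eq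
    exact ⟨n, by rw [Equiv.Perm.iterate_eq_pow, hn]⟩
  · rintro ⟨n, rfl⟩
    refine ⟨⟨f ^ n, n, by simp⟩, ?_⟩
    rw [Equiv.Perm.iterate_eq_pow]
    rfl

theorem ncard_orbitOf [Finite X] (f : Equiv.Perm X) (x : X) :
    (orbitOf f x).ncard = Function.minimalPeriod f x := by
  have := Fintype.ofFinite (MulAction.orbit (Subgroup.zpowers f) x)
  have h := MulAction.minimalPeriod_eq_card (a := f) (b := x)
  rw [← Nat.card_eq_fintype_card, Nat.card_coe_set_eq] at h
  exact h.symm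

theorem finsum_ncard_orbitsOf [Finite X] (f : Equiv.Perm X) :
    ∑ᶠ O ∈ orbitsOf f, O.ncard = Nat.card X := by
  have h : Setoid.IsPartition (orbitsOf f) := by
    convert Setoid.isPartition_classes (MulAction.orbitRel (Subgroup.zpowers f) X) using 1
    ext O
    constructor
    · rintro ⟨x, rfl⟩
      exact ⟨x, rfl⟩
    · rintro ⟨x, rfl⟩
      exact ⟨x, rfl⟩
  have h' := h.ncard_eq_finsum Set.univ
  rw [Set.ncard_univ] at h'
  rw [h', ← finsum_set_coe_eq_finsum_mem]
  simp

theorem semiconj_image_orbitOf [Finite X] {f : Equiv.Perm X} {g : Equiv.Perm Y} (e : X ≃ Y)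
    (h : ∀ x, e (f x) = g (e x)) (x : X) : e '' orbitOf f x = orbitOf g (e x) := by
  have : Finite Y := Finite.of_equiv X e
  have h' : Function.Semiconj e f g := h
  ext y
  simp only [Set.mem_image, mem_orbitOf_iff]
  constructor
  · rintro ⟨_, ⟨n, rfl⟩, rfl⟩
    exact ⟨n, (h'.iterate_right n x).symm⟩
  · rintro ⟨n, rfl⟩
    exact ⟨_, ⟨n, rfl⟩, h'.iterate_right n x⟩

theorem orbitsOf_eq_image_of_semiconj [Finite X] {f : Equiv.Perm X} {g : Equiv.Perm Y} (e : X ≃ Y)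
    (h : ∀ x, e (f x) = g (e x)) : orbitsOf g = (fun O => e '' O) '' orbitsOf f := by
  ext O
  constructor
  · rintro ⟨y, rfl⟩
    refine ⟨_, ⟨e.symm y, rfl⟩, ?_⟩
    have := semiconj_image_orbitOf e h (e.symm y)
    rw [e.apply_symm_apply] at this
    exact this
  · rintro ⟨_, ⟨x, rfl⟩, rfl⟩
    exact ⟨e x, (semiconj_image_orbitOf e h x).symm⟩

theorem statTotal_image (e : X ≃ Y) (st : Y → ℕ) (O : Set X) :
    statTotal st (e '' O) = statTotal (fun x => st (e x)) O :=
  finsum_mem_image e.injective.injOn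

theorem Set.disjoint_of_ncard_eq {S M : Set (Set X)} {s t : ℚ}
    (hS : ∀ O ∈ S, (O.ncard : ℚ) = s) (hM : ∀ O ∈ M, (O.ncard : ℚ) = t) (hst : s ≠ t) :
    Disjoint S M :=
  Set.disjoint_left.2 fun O h1 h2 => hst ((hS O h1).symm.trans (hM O h2))

theorem finsum_ncard_eq_mul [Finite X] {S : Set (Set X)} {s : ℕ} (hS : ∀ O ∈ S, O.ncard = s) :
    ∑ᶠ O ∈ S, O.ncard = S.ncard * s := by
  rw [finsum_mem_congr rfl hS, finsum_mem_eq_finite_toFinset_sum _ (Set.toFinite S),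
    Finset.sum_const, smul_eq_mul, Set.ncard_eq_toFinset_card S (Set.toFinite S)]

/-- The orbits of `f` are partitioned by length if the orbits are divided into three sets of orbits
of constant size, and these three sizes are distinct. -/
theorem OrbitsPartitionByLength.of_sizes {f : Equiv.Perm X} {c₁ s₁ c₂ s₂ c₃ s₃ : ℚ}
    {S M L : Set (Set X)} (hU : S ∪ M ∪ L = orbitsOf f)
    (h12 : s₁ ≠ s₂) (h13 : s₁ ≠ s₃) (h23 : s₂ ≠ s₃)
    (hS : ∀ O ∈ S, (O.ncard : ℚ) = s₁) (hM : ∀ O ∈ M, (O.ncard : ℚ) = s₂)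
    (hL : ∀ O ∈ L, (O.ncard : ℚ) = s₃)
    (cS : (S.ncard : ℚ) = c₁) (cM : (M.ncard : ℚ) = c₂) (cL : (L.ncard : ℚ) = c₃) :
    OrbitsPartitionByLength f c₁ s₁ c₂ s₂ c₃ s₃ := by
  refine ⟨S, M, L, hU, Set.disjoint_of_ncard_eq hS hM h12, Set.disjoint_of_ncard_eq hS hL h13,
    Set.disjoint_of_ncard_eq hM hL h23, cS, cM, cL, fun O hO => ?_⟩
  rw [← hU] at hO
  rcases hO with (hO | hO) | hO
  · have h := hS O hO
    exact ⟨iff_of_true hO h, ⟨hM O, fun h' => absurd (h.symm.trans h') h12⟩,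
      ⟨hL O, fun h' => absurd (h.symm.trans h') h13⟩⟩
  · have h := hM O hO
    exact ⟨⟨hS O, fun h' => absurd (h'.symm.trans h) h12⟩, iff_of_true hO h,
      ⟨hL O, fun h' => absurd (h.symm.trans h') h23⟩⟩
  · have h := hL O hO
    exact ⟨⟨hS O, fun h' => absurd (h'.symm.trans h) h13⟩,
      ⟨hM O, fun h' => absurd (h'.symm.trans h) h23⟩, iff_of_true hO h⟩

theorem OrbitsPartitionByLength.of_semiconj [Finite X] {f : Equiv.Perm X} {g : Equiv.Perm Y}
    (e : X ≃ Y) (h : ∀ x, e (f x) = g (e x)) {c₁ s₁ c₂ s₂ c₃ s₃ : ℚ}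
    (hf : OrbitsPartitionByLength f c₁ s₁ c₂ s₂ c₃ s₃) :
    OrbitsPartitionByLength g c₁ s₁ c₂ s₂ c₃ s₃ := by
  obtain ⟨S, M, L, hU, h12, h13, h23, cS, cM, cL, hO⟩ := hf
  have hinj : Function.Injective (fun O : Set X => e '' O) := Set.image_injective.2 e.injective
  refine ⟨(fun O => e '' O) '' S, (fun O => e '' O) '' M, (fun O => e '' O) '' L, ?_,
    (Set.disjoint_image_iff hinj).2 h12, (Set.disjoint_image_iff hinj).2 h13,
    (Set.disjoint_image_iff hinj).2 h23, ?_, ?_, ?_, ?_⟩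
  · rw [orbitsOf_eq_image_of_semiconj e h, ← hU, Set.image_union, Set.image_union]
  · rw [Set.ncard_image_of_injective _ hinj, cS]
  · rw [Set.ncard_image_of_injective _ hinj, cM]
  · rw [Set.ncard_image_of_injective _ hinj, cL]
  · rw [orbitsOf_eq_image_of_semiconj e h]
    rintro _ ⟨O, hO', rfl⟩
    simp only [hinj.mem_set_image, Set.ncard_image_of_injective _ e.injective]
    exact hO O hO'

theorem IsOrbomesic.of_semiconj [Finite X] {f : Equiv.Perm X} {g : Equiv.Perm Y}
    (e : X ≃ Y) (h : ∀ x, e (f x) = g (e x)) {st : Y → ℕ}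
    (hf : IsOrbomesic f fun x => st (e x)) : IsOrbomesic g st := by
  unfold IsOrbomesic
  rw [orbitsOf_eq_image_of_semiconj e h]
  rintro _ ⟨O₁, h₁, rfl⟩ _ ⟨O₂, h₂, rfl⟩ hcard
  simp only [Set.ncard_image_of_injective _ e.injective] at hcard
  simp only [statTotal_image]
  exact hf O₁ h₁ O₂ h₂ hcard

theorem IsMesic.of_semiconj [Finite X] {f : Equiv.Perm X} {g : Equiv.Perm Y}
    (e : X ≃ Y) (h : ∀ x, e (f x) = g (e x)) {st : Y → ℕ} {d : ℚ}
    (hf : IsMesic f (fun x => st (e x)) d) : IsMesic g st d := by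
  unfold IsMesic
  rw [orbitsOf_eq_image_of_semiconj e h]
  rintro _ ⟨O, hO, rfl⟩
  simp only [Set.ncard_image_of_injective _ e.injective, statTotal_image]
  exact hf O hO

open Classical in
/-- A statistic which up to a coboundary `u ∘ f - u` is a combination of the constant `1` and the
indicators of two sets has a total that is determined by the numbers of elements. -/
theorem statTotal_eq_of_coboundary [Finite X] {f : Equiv.Perm X} {st : X → ℕ} {u : X → ℚ}
    {U V : Set X} {c₀ c₁ c₂ : ℚ}
    (h : ∀ x, (st x : ℚ) = u (f x) - u x + c₀ + (if x ∈ U then c₁ else 0) +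
      (if x ∈ V then c₂ else 0)) {O : Set X} (hO : O ∈ orbitsOf f) :
    (statTotal st O : ℚ) = c₀ * O.ncard + c₁ * (O ∩ U).ncard + c₂ * (O ∩ V).ncard := by
  have hfin := Set.toFinite O
  have key : ∀ W : Set X, ((O ∩ W).ncard : ℚ) = (hfin.toFinset.filter (· ∈ W)).card := by
    intro W
    rw [← Set.ncard_coe_finset]
    congr 2
    ext x
    simp
  have hinv : ∑ x ∈ hfin.toFinset, u (f x) = ∑ x ∈ hfin.toFinset, u x := by
    obtain ⟨x₀, rfl⟩ := mem_orbitsOf.1 hO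
    have hmem : ∀ x, x ∈ orbitOf f x₀ ↔ f x ∈ orbitOf f x₀ := by
      intro x
      have h1 := orbitOf_eq_of_mem (f := f) (mem_orbitOf_iff.2 ⟨1, rfl⟩ : f x ∈ orbitOf f x)
      unfold orbitOf at h1 ⊢
      rw [← MulAction.orbit_eq_iff, ← MulAction.orbit_eq_iff, h1]
    refine Finset.sum_equiv f (fun x => ?_) (fun x _ => rfl)
    simp only [Set.Finite.mem_toFinset]
    exact hmem x
  have hst : statTotal st O = ∑ x ∈ hfin.toFinset, st x := finsum_mem_eq_finite_toFinset_sum _ hfin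
  rw [hst, key, key, Set.ncard_eq_toFinset_card O hfin, Nat.cast_sum]
  simp only [h, Finset.sum_add_distrib, Finset.sum_sub_distrib, hinv, Finset.sum_const,
    ← Finset.sum_filter, nsmul_eq_mul]
  ring

/-- `y` is the first point of `T` on the forward orbit of `x` after `x` itself, and it is reached
after `r` steps. -/
def FirstReturn (f : X → X) (T : Set X) (x : X) (r : ℕ) (y : X) : Prop :=
  0 < r ∧ f^[r] x = y ∧ ∀ s, 0 < s → s < r → f^[s] x ∉ T

/-- If successive returns to `T` lead from `y 0` through `y 1, …, y (p - 1)` back to `y 0`, then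
these are the points of `T` on the orbit, and the period is the sum of the return times. -/
theorem minimalPeriod_eq_sum_of_firstReturn {f : X → X} {T : Set X} {y : ℕ → X} {r : ℕ → ℕ}
    {p : ℕ} (hp : 0 < p) (h0 : y 0 ∈ T) (hret : ∀ n < p, FirstReturn f T (y n) (r n) (y (n + 1)))
    (hper : y p = y 0) (hinj : ∀ n, 0 < n → n < p → y n ≠ y 0) :
    Function.minimalPeriod f (y 0) = ∑ n ∈ Finset.range p, r n ∧
      (∀ m, f^[m] (y 0) ∈ T → ∃ n < p, f^[m] (y 0) = y n) ∧
      ∀ n < p, ∃ m, f^[m] (y 0) = y n := by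
  set τ : ℕ → ℕ := fun n => ∑ i ∈ Finset.range n, r i with hτ
  have τ_succ : ∀ n, τ (n + 1) = τ n + r n := fun n => Finset.sum_range_succ _ _
  have hit : ∀ n ≤ p, f^[τ n] (y 0) = y n := by
    intro n hn
    induction n with
    | zero => rfl
    | succ n ih => rw [τ_succ, add_comm, Function.iterate_add_apply, ih (by omega),
        (hret n (by omega)).2.1]
  have τp : 0 < τ p := by
    obtain ⟨p, rfl⟩ := Nat.exists_eq_succ_of_ne_zero hp.ne'
    have := (hret p (by omega)).1
    rw [τ_succ]
    omega
  have key : ∀ m < τ p, f^[m] (y 0) ∈ T → ∃ n < p, m = τ n := by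
    intro m hm hmT
    have hex : ∃ n, m < τ n := ⟨p, hm⟩
    obtain ⟨n, hn⟩ : ∃ n, Nat.find hex = n + 1 :=
      Nat.exists_eq_succ_of_ne_zero fun h => by
        have := Nat.find_spec hex
        rw [h] at this
        simp [hτ] at this
    have h1 : m < τ (n + 1) := hn ▸ Nat.find_spec hex
    have h2 : τ n ≤ m := not_lt.1 (Nat.find_min hex (by omega))
    have hnp : n < p := by
      have := Nat.find_min' hex hm
      omega
    refine ⟨n, hnp, ?_⟩
    by_contra hne
    refine (hret n hnp).2.2 (m - τ n) (by omega) (by rw [τ_succ] at h1; omega) ?_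
    rw [← hit n hnp.le, ← Function.iterate_add_apply, Nat.sub_add_cancel h2]
    exact hmT
  have hperiod : Function.IsPeriodicPt f (τ p) (y 0) := (hit p le_rfl).trans hper
  refine ⟨?_, ?_, fun n hn => ⟨τ n, hit n hn.le⟩⟩
  · refine le_antisymm (hperiod.minimalPeriod_le τp) (not_lt.1 fun hlt => ?_)
    have hmp := Function.iterate_minimalPeriod (f := f) (x := y 0)
    obtain ⟨n, hn, hmn⟩ := key _ hlt (by rw [hmp]; exact h0)
    rcases Nat.eq_zero_or_pos n with rfl | hpos
    · have := hperiod.minimalPeriod_pos τp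
      rw [hmn] at this
      simp [hτ] at this
    · refine hinj n hpos hn ?_
      rw [← hit n hn.le, ← hmn, hmp]
  · intro m hm
    rw [← hperiod.iterate_mod_apply m] at hm ⊢
    obtain ⟨n, hn, hmn⟩ := key _ (Nat.mod_lt _ τp) hm
    exact ⟨n, hn, by rw [hmn, hit n hn.le]⟩

end OrbitLemmas

/-! ### The orbits of rowmotion in coordinates -/

namespace FenceState

variable {a b : ℕ}

/-- The ideals that contain the peak. -/
def peaks (a b : ℕ) : Set (FenceState a b) := Set.range peak

/-- The ideals that do not contain the valley. -/
def noValleys (a b : ℕ) : Set (FenceState a b) := Set.range noValley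

@[simp] theorem mid_notMem_peaks (i : ZMod a) (j : ZMod b) (k : ZMod a) :
    mid i j k ∉ peaks a b := by rintro ⟨_, h⟩; cases h

@[simp] theorem mid_notMem_noValleys (i : ZMod a) (j : ZMod b) (k : ZMod a) :
    mid i j k ∉ noValleys a b := by rintro ⟨_, h⟩; cases h

@[simp] theorem peak_mem_peaks (k : ZMod a) : peak k ∈ peaks a b := ⟨k, rfl⟩

@[simp] theorem peak_notMem_noValleys (k : ZMod a) : peak k ∉ noValleys a b := by
  rintro ⟨_, h⟩; cases h

@[simp] theorem noValley_mem_noValleys (i : ZMod a) : noValley i ∈ noValleys a b := ⟨i, rfl⟩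

@[simp] theorem noValley_notMem_peaks (i : ZMod a) : noValley i ∉ peaks a b := by
  rintro ⟨_, h⟩; cases h

theorem iterate_step_mid {i : ZMod a} {j : ZMod b} {k : ZMod a} {n : ℕ}
    (h : ∀ t < n, ¬ (i + t = -1 ∧ j + t = -1) ∧ ¬ (j + t = -1 ∧ k + t = -1)) :
    step^[n] (mid i j k) = mid (i + (n : ZMod a)) (j + (n : ZMod b)) (k + (n : ZMod a)) := by
  induction n with
  | zero => simp
  | succ n ih =>
    rw [Function.iterate_succ_apply', ih fun t ht => h t (by omega)]
    simp only [step, if_neg (h n (by omega)).1, if_neg (h n (by omega)).2]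
    push_cast
    simp only [add_assoc]

/-- A return to the pausing states from `x`, whose successor is `mid i j k`: it takes place when
two coordinates are about to return to `0` together for the first time. -/
theorem firstReturn_of_step_eq_mid {x z : FenceState a b} {i : ZMod a} {j : ZMod b} {k : ZMod a}
    (hx : x.step = mid i j k) (n : ℕ)
    (h : ∀ t < n, ¬ (i + t = -1 ∧ j + t = -1) ∧ ¬ (j + t = -1 ∧ k + t = -1))
    (hz : step (mid (i + (n : ZMod a)) (j + (n : ZMod b)) (k + (n : ZMod a))) = z) :
    FirstReturn step (peaks a b ∪ noValleys a b) x (n + 2) z := by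
  refine ⟨by omega, ?_, fun s h1 h2 => ?_⟩
  · rw [show n + 2 = n + 1 + 1 from rfl, Function.iterate_succ_apply, hx,
      Function.iterate_succ_apply', iterate_step_mid h, hz]
  · obtain ⟨s, rfl⟩ := Nat.exists_eq_succ_of_ne_zero h1.ne'
    rw [Function.iterate_succ_apply, hx, iterate_step_mid fun t ht => h t (by omega)]
    simp

theorem natCast_eq_neg_one_iff {n t : ℕ} : (t : ZMod n) = -1 ↔ n ∣ t + 1 := by
  rw [eq_neg_iff_add_eq_zero, ← ZMod.natCast_eq_zero_iff]
  push_cast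
  rfl

variable [NeZero a] [NeZero b]

theorem lcm_pos : 0 < a.lcm b :=
  Nat.lcm_pos (Nat.pos_of_ne_zero (NeZero.ne a)) (Nat.pos_of_ne_zero (NeZero.ne b))

/-- The first two coordinates, which leave `peak k` together, return together after `lcm a b`
steps. The hypothesis says that the last two coordinates never return together. -/
theorem firstReturn_peak_peak {k : ZMod a} (hk : ∀ c : ℕ, k + 1 + (b * c : ℕ) ≠ 0) :
    FirstReturn step (peaks a b ∪ noValleys a b) (peak k) (a.lcm b + 1) (peak (k + 1)) := by
  have hl : 0 < a.lcm b := lcm_pos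
  have hk0 : k ≠ -1 := by
    have := hk 0
    rwa [mul_zero, Nat.cast_zero, add_zero, ne_eq, ← eq_neg_iff_add_eq_zero] at this
  have hcast : ((a.lcm b - 1 : ℕ) : ZMod a) = -1 ∧ ((a.lcm b - 1 : ℕ) : ZMod b) = -1 := by
    rw [natCast_eq_neg_one_iff, natCast_eq_neg_one_iff, Nat.sub_add_cancel hl]
    exact ⟨Nat.dvd_lcm_left a b, Nat.dvd_lcm_right a b⟩
  have h := firstReturn_of_step_eq_mid (x := (peak k : FenceState a b)) (z := peak (k + 1))
    (show step (peak k) = _ by simp only [step, if_neg hk0]; rfl) (a.lcm b - 1) ?_ ?_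
  · rwa [show a.lcm b - 1 + 2 = a.lcm b + 1 by omega] at h
  · intro t ht
    simp only [zero_add, natCast_eq_neg_one_iff]
    constructor
    · rintro ⟨h1, h2⟩
      have := Nat.le_of_dvd (by omega) (Nat.lcm_dvd h1 h2)
      omega
    · rintro ⟨⟨c, hc⟩, h2⟩
      refine hk c ?_
      rw [← hc, Nat.cast_add, Nat.cast_one, ← add_assoc, h2, neg_add_cancel]
  · simp only [zero_add, step, hcast, and_self, if_true]
    congr 1
    ring

/-- The last two coordinates, which leave `noValley i` together, return together after `lcm a b`
steps. The hypothesis says that the first two coordinates never return together. -/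
theorem firstReturn_noValley_noValley {i : ZMod a} (hi : ∀ c : ℕ, i + 1 + (b * c : ℕ) ≠ 0) :
    FirstReturn step (peaks a b ∪ noValleys a b) (noValley i) (a.lcm b + 1) (noValley (i + 1)) := by
  have hl : 0 < a.lcm b := lcm_pos
  have hcast : ((a.lcm b - 1 : ℕ) : ZMod a) = -1 ∧ ((a.lcm b - 1 : ℕ) : ZMod b) = -1 := by
    rw [natCast_eq_neg_one_iff, natCast_eq_neg_one_iff, Nat.sub_add_cancel hl]
    exact ⟨Nat.dvd_lcm_left a b, Nat.dvd_lcm_right a b⟩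
  have hno : ∀ t : ℕ, ¬ (i + 1 + t = -1 ∧ b ∣ t + 1) := by
    rintro t ⟨h2, ⟨c, hc⟩⟩
    refine hi c ?_
    rw [← hc, Nat.cast_add, Nat.cast_one, ← add_assoc, h2, neg_add_cancel]
  have h := firstReturn_of_step_eq_mid (x := (noValley i : FenceState a b))
    (z := noValley (i + 1)) rfl (a.lcm b - 1) ?_ ?_
  · rwa [show a.lcm b - 1 + 2 = a.lcm b + 1 by omega] at h
  · intro t ht
    simp only [zero_add, natCast_eq_neg_one_iff]
    constructor
    · exact hno t
    · rintro ⟨h1, h2⟩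
      have := Nat.le_of_dvd (by omega) (Nat.lcm_dvd h2 h1)
      omega
  · have hi' : i + 1 + ((a.lcm b - 1 : ℕ) : ZMod a) ≠ -1 := fun h =>
      hno _ ⟨h, natCast_eq_neg_one_iff.1 hcast.2⟩
    rw [hcast.1] at hi'
    simp only [zero_add, step, hcast, hi', and_self, false_and, if_true, if_false]
    congr 1
    ring

omit [NeZero a] [NeZero b] in
/-- Two counters modulo `a` and `b` that are `n` and `0` steps away from `0` cannot both arrive at
`0` within fewer than `n` steps if `b` divides `n` and `n ≤ lcm a b`. -/
theorem not_dvd_of_lt_lcm {n t : ℕ} (hb : b ∣ n) (hn : n ≤ a.lcm b) (ht : t + 1 < n) :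
    ¬ (-(n : ZMod a) + t = -1 ∧ b ∣ t + 1) := by
  rintro ⟨h1, h2⟩
  have h3 : ((n - (t + 1) : ℕ) : ZMod a) = 0 := by
    rw [Nat.cast_sub ht.le, Nat.cast_add, Nat.cast_one]
    linear_combination -h1
  rw [ZMod.natCast_eq_zero_iff] at h3
  have := Nat.le_of_dvd (by omega) (Nat.lcm_dvd h3 (Nat.dvd_sub hb h2))
  omega

omit [NeZero a] [NeZero b] in
/-- From `peak (-1 - b * c)` the last two coordinates return together after `b * c` steps, before
the first two do. For `b * c = 0` this happens at once, in the step from `peak (-1)`. -/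
theorem firstReturn_peak_noValley {c : ℕ} (hc : b * c < a.lcm b) :
    FirstReturn step (peaks a b ∪ noValleys a b) (peak (-1 - (b * c : ℕ))) (b * c + 1)
      (noValley (b * c : ℕ)) := by
  rcases Nat.eq_zero_or_pos (b * c) with h0 | h0
  · rw [h0]
    refine ⟨by omega, ?_, fun s h1 h2 => by omega⟩
    simp [step]
  · have hne : (-1 - (b * c : ℕ) : ZMod a) ≠ -1 := by
      intro h
      have h1 : ((b * c : ℕ) : ZMod a) = 0 := by linear_combination -h
      rw [ZMod.natCast_eq_zero_iff] at h1
      have := Nat.le_of_dvd h0 (Nat.lcm_dvd h1 (dvd_mul_right b c))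
      omega
    have hcast : ((b * c - 1 : ℕ) : ZMod b) = -1 := by
      rw [natCast_eq_neg_one_iff, Nat.sub_add_cancel h0]
      exact dvd_mul_right b c
    have hcast' : ((b * c - 1 : ℕ) : ZMod a) = (b * c : ℕ) - 1 := by
      rw [Nat.cast_sub h0, Nat.cast_one]
    have h := firstReturn_of_step_eq_mid (x := (peak (-1 - (b * c : ℕ)) : FenceState a b))
      (z := noValley (b * c : ℕ)) (i := 0) (j := 0) (k := -(b * c : ℕ))
      ?_ (b * c - 1) ?_ ?_
    · rwa [show b * c - 1 + 2 = b * c + 1 by omega] at h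
    · simp only [step, if_neg hne]
      congr 1
      ring
    · intro t ht
      constructor
      · simp only [zero_add, natCast_eq_neg_one_iff]
        rintro ⟨h1, h2⟩
        have := Nat.le_of_dvd (by omega) (Nat.lcm_dvd h1 h2)
        omega
      · simp only [zero_add, natCast_eq_neg_one_iff (n := b)]
        rintro ⟨h1, h2⟩
        exact not_dvd_of_lt_lcm (dvd_mul_right b c) hc.le (by omega) ⟨h2, h1⟩
    · have hi : ((b * c - 1 : ℕ) : ZMod a) ≠ -1 := by
        rw [ne_eq, natCast_eq_neg_one_iff, Nat.sub_add_cancel h0]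
        intro h
        have := Nat.le_of_dvd h0 (Nat.lcm_dvd h (dvd_mul_right b c))
        omega
      have hk : -((b * c : ℕ) : ZMod a) + ((b * c - 1 : ℕ) : ZMod a) = -1 := by
        rw [hcast']
        ring
      simp only [zero_add, step, hi, hk, hcast, false_and, and_self, if_true, if_false]
      rw [hcast', sub_add_cancel]

omit [NeZero a] [NeZero b] in
/-- From `noValley (-1 - b * d)` the first two coordinates return together after `b * d` steps. If
`b * d = lcm a b`, then the last two are about to return at the same time, but the first two take
precedence and the last two do not pause. -/
theorem firstReturn_noValley_peak {d : ℕ} (hd : 0 < b * d) (hd' : b * d ≤ a.lcm b) :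
    FirstReturn step (peaks a b ∪ noValleys a b) (noValley (-1 - (b * d : ℕ))) (b * d + 1)
      (peak (b * d : ℕ)) := by
  have hcast : ((b * d - 1 : ℕ) : ZMod b) = -1 := by
    rw [natCast_eq_neg_one_iff, Nat.sub_add_cancel hd]
    exact dvd_mul_right b d
  have hcast' : ((b * d - 1 : ℕ) : ZMod a) = (b * d : ℕ) - 1 := by
    rw [Nat.cast_sub hd, Nat.cast_one]
  have h := firstReturn_of_step_eq_mid (x := (noValley (-1 - (b * d : ℕ)) : FenceState a b))
    (z := peak (b * d : ℕ)) (i := -(b * d : ℕ)) (j := 0) (k := 0) ?_ (b * d - 1) ?_ ?_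
  · rwa [show b * d - 1 + 2 = b * d + 1 by omega] at h
  · simp only [step]
    congr 1
    ring
  · intro t ht
    constructor
    · simp only [zero_add, natCast_eq_neg_one_iff (n := b)]
      exact not_dvd_of_lt_lcm (dvd_mul_right b d) hd' (by omega)
    · simp only [zero_add, natCast_eq_neg_one_iff]
      rintro ⟨h1, h2⟩
      have := Nat.le_of_dvd (by omega) (Nat.lcm_dvd h2 h1)
      omega
  · have hi : -((b * d : ℕ) : ZMod a) + ((b * d - 1 : ℕ) : ZMod a) = -1 := by
      rw [hcast']
      ring
    simp only [zero_add, step, hi, hcast, and_self, if_true]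
    rw [hcast', sub_add_cancel]

end FenceState

/-! ### The size and the pauses of an orbit -/

namespace FenceState

variable {a b : ℕ} [NeZero a] [NeZero b]

theorem coe_stepPerm : ⇑(stepPerm a b) = step := funext stepPerm_apply

/-- The sequence of pausing states on the orbit of `peak (b * d)`. -/
def pauses (a b c d n : ℕ) : FenceState a b :=
  if n < a.gcd b then peak (b * d + n : ℕ)
  else if n < 2 * a.gcd b then noValley (b * c + (n - a.gcd b) : ℕ)
  else peak (b * d : ℕ)

/-- The numbers of steps between the pausing states on the orbit of `peak (b * d)`. -/
def pauseTimes (a b c d n : ℕ) : ℕ :=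
  if n + 1 = a.gcd b then b * c + 1
  else if n + 1 = 2 * a.gcd b then b * d + 1
  else a.lcm b + 1

omit [NeZero a] [NeZero b] in
/-- For `0 < n < gcd a b`, the residue class `n` modulo `a` is not a multiple of `b`. -/
theorem natCast_mul_add_ne_zero {e n : ℕ} (h0 : 0 < n) (hn : n < a.gcd b) (c : ℕ) :
    ((b * e + n : ℕ) : ZMod a) + (b * c : ℕ) ≠ 0 := by
  intro h
  rw [← Nat.cast_add, ZMod.natCast_eq_zero_iff] at h
  have h1 : a.gcd b ∣ b * e + n + b * c := (Nat.gcd_dvd_left a b).trans h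
  have h2 : a.gcd b ∣ n := by
    rw [Nat.dvd_add_left ((Nat.gcd_dvd_right a b).mul_right c),
      Nat.dvd_add_right ((Nat.gcd_dvd_right a b).mul_right e)] at h1
    exact h1
  have := Nat.le_of_dvd h0 h2
  omega

theorem firstReturn_pauses {c d : ℕ} (hc : b * c < a.lcm b) (hd : 0 < b * d)
    (hd' : b * d ≤ a.lcm b) (hcd : ((b * (c + d) + a.gcd b : ℕ) : ZMod a) = 0) {n : ℕ}
    (hn : n < 2 * a.gcd b) :
    FirstReturn step (peaks a b ∪ noValleys a b) (pauses a b c d n) (pauseTimes a b c d n)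
      (pauses a b c d (n + 1)) := by
  unfold pauses pauseTimes
  have hsucc : ∀ e k : ℕ, ((b * e + k : ℕ) : ZMod a) + 1 = (b * e + (k + 1) : ℕ) := by
    intro e k
    push_cast
    ring
  -- The last step before a change of kind: `b * e + (g - 1)` is `-1 - b * e'`, as
  -- `b * (e + e') + g = 0`.
  have hlast : ∀ e e' k : ℕ, e + e' = c + d → k + 1 = a.gcd b →
      ((b * e + k : ℕ) : ZMod a) = -1 - (b * e' : ℕ) := by
    intro e e' k he hk
    rw [← he, ← hk] at hcd
    push_cast at hcd ⊢
    linear_combination hcd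
  rcases lt_trichotomy (n + 1) (a.gcd b) with h | h | h
  · rw [if_pos (by omega), if_neg (by omega), if_neg (by omega), if_pos h, ← hsucc]
    refine firstReturn_peak_peak fun c' => ?_
    rw [hsucc]
    exact natCast_mul_add_ne_zero (by omega) h c'
  · rw [if_pos (by omega), if_pos h, if_neg (by omega), if_pos (by omega),
      hlast d c n (add_comm _ _) h, h, Nat.sub_self, add_zero]
    exact firstReturn_peak_noValley hc
  · rw [if_neg (by omega), if_pos hn, if_neg (by omega)]
    by_cases h' : n + 1 = 2 * a.gcd b
    · rw [if_pos h', if_neg (by omega), if_neg (by omega),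
        hlast c d (n - a.gcd b) rfl (by omega)]
      exact firstReturn_noValley_peak hd hd'
    · rw [if_neg h', if_neg (by omega), if_pos (by omega),
        show n + 1 - a.gcd b = n - a.gcd b + 1 by omega, ← hsucc]
      refine firstReturn_noValley_noValley fun c' => ?_
      rw [hsucc]
      exact natCast_mul_add_ne_zero (by omega) (by omega) c'

omit [NeZero b] in
theorem natCast_mul_add_injOn (e : ℕ) :
    Set.InjOn (fun n : ℕ => ((b * e + n : ℕ) : ZMod a)) (Set.Iio (a.gcd b)) := by
  have hle : a.gcd b ≤ a := Nat.gcd_le_left b (Nat.pos_of_ne_zero (NeZero.ne a))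
  intro n hn n' hn' h
  simp only [Nat.cast_add, add_right_inj] at h
  rw [ZMod.natCast_eq_natCast_iff', Nat.mod_eq_of_lt (hn.trans_le hle),
    Nat.mod_eq_of_lt (hn'.trans_le hle)] at h
  exact h

omit [NeZero b] in
theorem sum_pauseTimes (c d : ℕ) : ∑ n ∈ Finset.range (2 * a.gcd b), pauseTimes a b c d n =
    2 * (a.gcd b - 1) * (a.lcm b + 1) + b * (c + d) + 2 := by
  have hg : 0 < a.gcd b := Nat.gcd_pos_of_pos_left b (Nat.pos_of_ne_zero (NeZero.ne a))
  unfold pauseTimes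
  obtain ⟨g, hg'⟩ := Nat.exists_eq_succ_of_ne_zero hg.ne'
  rw [hg', two_mul, Finset.sum_range_add, Finset.sum_range_succ, Finset.sum_range_succ]
  have h1 : ∑ n ∈ Finset.range g, (if n + 1 = g.succ then b * c + 1
      else if n + 1 = g.succ + g.succ then b * d + 1 else a.lcm b + 1) = g * (a.lcm b + 1) := by
    rw [Finset.sum_congr rfl (g := fun _ => a.lcm b + 1), Finset.sum_const, Finset.card_range,
      smul_eq_mul]
    intro n hn
    rw [Finset.mem_range] at hn
    rw [if_neg (by omega), if_neg (by omega)]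
  have h2 : ∑ n ∈ Finset.range g, (if g.succ + n + 1 = g.succ then b * c + 1
      else if g.succ + n + 1 = g.succ + g.succ then b * d + 1 else a.lcm b + 1) =
      g * (a.lcm b + 1) := by
    rw [Finset.sum_congr rfl (g := fun _ => a.lcm b + 1), Finset.sum_const, Finset.card_range,
      smul_eq_mul]
    intro n hn
    rw [Finset.mem_range] at hn
    rw [if_neg (by omega), if_neg (by omega)]
  rw [h1, h2, if_pos rfl, if_neg (by omega), if_pos (by omega), Nat.succ_sub_one]
  ring

section Orbit

variable {c d : ℕ} (hc : b * c < a.lcm b) (hd : 0 < b * d) (hd' : b * d ≤ a.lcm b)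
  (hcd : ((b * (c + d) + a.gcd b : ℕ) : ZMod a) = 0)
include hc hd hd' hcd

/-- The size of the orbit of `peak (b * d)` and its pausing states. -/
theorem orbit_peak :
    (orbitOf (stepPerm a b) (peak (b * d : ℕ))).ncard =
      2 * (a.gcd b - 1) * (a.lcm b + 1) + b * (c + d) + 2 ∧
    ∀ s ∈ peaks a b ∪ noValleys a b, s ∈ orbitOf (stepPerm a b) (peak (b * d : ℕ)) ↔
      ∃ n < 2 * a.gcd b, s = pauses a b c d n := by
  have hg : 0 < a.gcd b := Nat.gcd_pos_of_pos_left b (Nat.pos_of_ne_zero (NeZero.ne a))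
  have : Finite (FenceState a b) := Finite.of_equiv _ (equivIdeal a b).symm
  have h0 : pauses a b c d 0 = peak (b * d : ℕ) := by
    unfold pauses
    rw [if_pos hg, add_zero]
  have hend : pauses a b c d (2 * a.gcd b) = pauses a b c d 0 := by
    rw [h0]
    unfold pauses
    rw [if_neg (by omega), if_neg (by omega)]
  have hinj : ∀ n, 0 < n → n < 2 * a.gcd b → pauses a b c d n ≠ pauses a b c d 0 := by
    intro n h1 h2 h
    unfold pauses at h
    rw [if_pos hg] at h
    split_ifs at h with h3
    · rw [peak.injEq] at h
      exact h1.ne' (natCast_mul_add_injOn d h3 hg h)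
  obtain ⟨hper, hT, hex⟩ := minimalPeriod_eq_sum_of_firstReturn (f := step)
    (T := peaks a b ∪ noValleys a b) (y := pauses a b c d) (r := pauseTimes a b c d)
    (p := 2 * a.gcd b) (by omega) (by rw [h0]; simp)
    (fun n hn => firstReturn_pauses hc hd hd' hcd hn) hend hinj
  rw [h0] at hper hT hex
  constructor
  · rw [ncard_orbitOf, coe_stepPerm, hper, sum_pauseTimes]
  · intro s hs
    rw [mem_orbitOf_iff, coe_stepPerm]
    constructor
    · rintro ⟨n, rfl⟩
      exact hT n hs
    · rintro ⟨n, hn, rfl⟩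
      exact hex n hn

theorem peak_mem_orbit_peak_iff (k : ZMod a) :
    peak k ∈ orbitOf (stepPerm a b) (peak (b * d : ℕ)) ↔
      ∃ n < a.gcd b, ((b * d + n : ℕ) : ZMod a) = k := by
  rw [(orbit_peak hc hd hd' hcd).2 _ (by simp)]
  unfold pauses
  constructor
  · rintro ⟨n, hn, h⟩
    split_ifs at h with h1
    exact ⟨n, h1, (peak.inj h).symm⟩
  · rintro ⟨n, hn, rfl⟩
    exact ⟨n, by omega, by rw [if_pos hn]⟩

theorem noValley_mem_orbit_peak_iff (i : ZMod a) :
    noValley i ∈ orbitOf (stepPerm a b) (peak (b * d : ℕ)) ↔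
      ∃ n < a.gcd b, ((b * c + n : ℕ) : ZMod a) = i := by
  rw [(orbit_peak hc hd hd' hcd).2 _ (by simp)]
  unfold pauses
  constructor
  · rintro ⟨n, hn, h⟩
    split_ifs at h with h1
    exact ⟨n - a.gcd b, by omega, (noValley.inj h).symm⟩
  · rintro ⟨n, hn, rfl⟩
    refine ⟨n + a.gcd b, by omega, ?_⟩
    rw [if_neg (by omega), if_pos (by omega), Nat.add_sub_cancel]

theorem ncard_orbit_peak_inter_peaks :
    (orbitOf (stepPerm a b) (peak (b * d : ℕ)) ∩ peaks a b).ncard = a.gcd b := by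
  have h : orbitOf (stepPerm a b) (peak (b * d : ℕ)) ∩ peaks a b =
      (fun n : ℕ => peak ((b * d + n : ℕ) : ZMod a)) '' Set.Iio (a.gcd b) := by
    ext s
    constructor
    · rintro ⟨hs, k, rfl⟩
      obtain ⟨n, hn, rfl⟩ := (peak_mem_orbit_peak_iff hc hd hd' hcd k).1 hs
      exact ⟨n, hn, rfl⟩
    · rintro ⟨n, hn, rfl⟩
      exact ⟨(peak_mem_orbit_peak_iff hc hd hd' hcd _).2 ⟨n, hn, rfl⟩, by simp⟩
  rw [h, Set.InjOn.ncard_image fun n hn n' hn' h => natCast_mul_add_injOn d hn hn' (peak.inj h),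
    ← Finset.coe_Iio, Set.ncard_coe_finset, Nat.card_Iio]

theorem ncard_orbit_peak_inter_noValleys :
    (orbitOf (stepPerm a b) (peak (b * d : ℕ)) ∩ noValleys a b).ncard = a.gcd b := by
  have h : orbitOf (stepPerm a b) (peak (b * d : ℕ)) ∩ noValleys a b =
      (fun n : ℕ => noValley ((b * c + n : ℕ) : ZMod a)) '' Set.Iio (a.gcd b) := by
    ext s
    constructor
    · rintro ⟨hs, k, rfl⟩
      obtain ⟨n, hn, rfl⟩ := (noValley_mem_orbit_peak_iff hc hd hd' hcd k).1 hs
      exact ⟨n, hn, rfl⟩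
    · rintro ⟨n, hn, rfl⟩
      exact ⟨(noValley_mem_orbit_peak_iff hc hd hd' hcd _).2 ⟨n, hn, rfl⟩, by simp⟩
  rw [h, Set.InjOn.ncard_image fun n hn n' hn' h => natCast_mul_add_injOn c hn hn' (noValley.inj h),
    ← Finset.coe_Iio, Set.ncard_coe_finset, Nat.card_Iio]

end Orbit

/-- An orbit without pauses has size `lcm a b`: on it, all coordinates advance freely. -/
theorem ncard_orbit_of_disjoint {O : Set (FenceState a b)} (hO : O ∈ orbitsOf (stepPerm a b))
    (h : Disjoint O (peaks a b ∪ noValleys a b)) : O.ncard = a.lcm b := by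
  have : Finite (FenceState a b) := Finite.of_equiv _ (equivIdeal a b).symm
  obtain ⟨x, rfl⟩ := mem_orbitsOf.1 hO
  have hno : ∀ n, step^[n] x ∉ peaks a b ∪ noValleys a b := fun n =>
    Set.disjoint_left.1 h (mem_orbitOf_iff.2 ⟨n, by rw [coe_stepPerm]⟩)
  rcases x with ⟨i, j, k⟩ | k | i
  · have hit : ∀ n : ℕ, step^[n] (mid i j k) =
        mid (i + (n : ZMod a)) (j + (n : ZMod b)) (k + (n : ZMod a)) := by
      intro n
      refine iterate_step_mid fun t _ => ?_
      induction t using Nat.strong_induction_on with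
      | _ t ih =>
        have h1 := hno (t + 1)
        rw [Function.iterate_succ_apply', iterate_step_mid fun t' ht' => ih t' ht' (by omega)] at h1
        simp only [step] at h1
        split_ifs at h1 with h2 h3 <;> simp at h1
        exact ⟨h2, h3⟩
    rw [ncard_orbitOf, coe_stepPerm]
    have hiff : ∀ n, Function.IsPeriodicPt step n (mid i j k) ↔ a.lcm b ∣ n := by
      intro n
      unfold Function.IsPeriodicPt Function.IsFixedPt
      rw [hit, mid.injEq, Nat.lcm_dvd_iff, ← ZMod.natCast_eq_zero_iff, ← ZMod.natCast_eq_zero_iff]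
      simp only [add_eq_left]
      tauto
    refine Nat.dvd_antisymm ((hiff _).2 dvd_rfl).minimalPeriod_dvd ?_
    exact (hiff _).1 (Function.isPeriodicPt_minimalPeriod _ _)
  · exact absurd (by simp) (hno 0)
  · exact absurd (by simp) (hno 0)

variable (a b) in
theorem natCard_fenceState : Nat.card (FenceState a b) = a * b * a + 2 * a := by
  let e : FenceState a b ≃ (ZMod a × ZMod b × ZMod a) ⊕ ZMod a ⊕ ZMod a :=
    { toFun := fun s => match s with
        | mid i j k => Sum.inl (i, j, k)
        | peak k => Sum.inr (Sum.inl k)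
        | noValley i => Sum.inr (Sum.inr i)
      invFun := fun s => match s with
        | Sum.inl (i, j, k) => mid i j k
        | Sum.inr (Sum.inl k) => peak k
        | Sum.inr (Sum.inr i) => noValley i
      left_inv := by rintro (_ | _ | _) <;> rfl
      right_inv := by rintro (⟨_, _, _⟩ | _ | _) <;> rfl }
  rw [Nat.card_congr e, Nat.card_sum, Nat.card_sum, Nat.card_prod, Nat.card_prod, Nat.card_zmod,
    Nat.card_zmod]
  ring

end FenceState

namespace FenceState

/-! ### The statistics up to coboundaries -/

/-- The function `r (r - n) / 2` of the representative `r` of a residue class modulo `n`. -/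
def halfProd {n : ℕ} (x : ZMod n) : ℚ := x.val * (x.val - n) / 2

@[simp] theorem halfProd_zero {n : ℕ} : halfProd (0 : ZMod n) = 0 := by simp [halfProd]

theorem halfProd_add_one {n : ℕ} [NeZero n] (x : ZMod n) :
    halfProd (x + 1) = halfProd x + (x.val - ((n : ℚ) - 1) / 2) := by
  unfold halfProd
  rw [ZMod.val_add_one_eq]
  split_ifs with h
  · rw [ZMod.eq_neg_one_iff_val] at h
    have h' : (x.val : ℚ) + 1 = n := by exact_mod_cast h
    rw [← h']
    push_cast
    ring
  · push_cast
    ring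

/-- The representative of a residue class modulo `n`, divided by `n`. -/
def fraction {n : ℕ} (x : ZMod n) : ℚ := x.val / n

@[simp] theorem fraction_zero {n : ℕ} : fraction (0 : ZMod n) = 0 := by simp [fraction]

theorem fraction_add_one {n : ℕ} [NeZero n] (x : ZMod n) :
    fraction (x + 1) = fraction x + 1 / n - if x = -1 then 1 else 0 := by
  have hn : (n : ℚ) ≠ 0 := Nat.cast_ne_zero.2 (NeZero.ne n)
  unfold fraction
  rw [ZMod.val_add_one_eq]
  split_ifs with h
  · rw [ZMod.eq_neg_one_iff_val] at h
    have h' : (x.val : ℚ) = n - 1 := eq_sub_of_add_eq (by exact_mod_cast h)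
    rw [h']
    field_simp
    push_cast
    ring
  · push_cast
    ring

variable {a b : ℕ}

/-- A potential for the size of an ideal. -/
def idealPotential : FenceState a b → ℚ
  | mid i j k => halfProd i + halfProd j + halfProd k
  | peak k => halfProd k
  | noValley i => halfProd i

/-- A potential for the size of an antichain. -/
def antichainPotential : FenceState a b → ℚ
  | mid i j k => fraction i + fraction j + fraction k
  | peak k => fraction k + 1
  | noValley i => fraction i

variable [NeZero a] [NeZero b]

open Classical in
/-- The size of an ideal is half the size of the fence, up to a coboundary and up to the pauses,
where the two kinds of pauses contribute with opposite signs. -/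
theorem idealSize_eq (s : FenceState a b) : (s.idealSize : ℚ) =
    idealPotential (stepPerm a b s) - idealPotential s + (2 * a + b - 1) / 2 +
    (if s ∈ peaks a b then ((a : ℚ) + b) / 2 else 0) +
    (if s ∈ noValleys a b then -((a : ℚ) + b) / 2 else 0) := by
  rw [stepPerm_apply]
  rcases s with ⟨i, j, k⟩ | k | i
  · have hi := halfProd_add_one i
    have hj := halfProd_add_one j
    have hk := halfProd_add_one k
    simp only [step, mid_notMem_peaks, mid_notMem_noValleys, if_false]
    split_ifs with h1 h2
    · rw [h1.1, neg_add_cancel, halfProd_zero] at hi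
      rw [h1.2, neg_add_cancel, halfProd_zero] at hj
      simp only [idealSize, idealPotential, hk, h1.1, h1.2]
      push_cast
      linear_combination -hi - hj
    · rw [h2.1, neg_add_cancel, halfProd_zero] at hj
      rw [h2.2, neg_add_cancel, halfProd_zero] at hk
      simp only [idealSize, idealPotential, hi, h2.1, h2.2]
      push_cast
      linear_combination -hj - hk
    · simp only [idealSize, idealPotential, hi, hj, hk]
      push_cast
      ring
  · have hk := halfProd_add_one k
    simp only [step, peak_mem_peaks, peak_notMem_noValleys, if_true, if_false]
    split_ifs with h
    · rw [h, neg_add_cancel, halfProd_zero] at hk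
      simp only [idealSize, idealPotential, h, halfProd_zero]
      push_cast
      linear_combination -hk
    · simp only [idealSize, idealPotential, hk, halfProd_zero]
      push_cast
      ring
  · have hi := halfProd_add_one i
    simp only [step, noValley_notMem_peaks, noValley_mem_noValleys, if_true, if_false]
    simp only [idealSize, idealPotential, hi, halfProd_zero]
    ring

open Classical in
/-- The size of an antichain is a constant, up to a coboundary and up to the pauses. -/
theorem antichainSize_eq (s : FenceState a b) : (s.antichainSize : ℚ) =
    antichainPotential (stepPerm a b s) - antichainPotential s + (3 - 2 / (a : ℚ) - 1 / b) +
    (if s ∈ peaks a b then 1 / (a : ℚ) + 1 / b - 1 else 0) +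
    (if s ∈ noValleys a b then 1 / (a : ℚ) + 1 / b - 1 else 0) := by
  rw [stepPerm_apply]
  rcases s with ⟨i, j, k⟩ | k | i
  · have hi := fraction_add_one i
    have hj := fraction_add_one j
    have hk := fraction_add_one k
    simp only [step, mid_notMem_peaks, mid_notMem_noValleys, if_false]
    split_ifs with h1 h2
    · rw [h1.1, neg_add_cancel, fraction_zero, if_pos rfl] at hi
      rw [h1.2, neg_add_cancel, fraction_zero, if_pos rfl] at hj
      simp only [antichainSize, antichainPotential, hk, h1.1, h1.2, and_self, if_true]
      split_ifs <;> push_cast <;> linear_combination -hi - hj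
    · have hi1 : i ≠ -1 := fun hi1 => h1 ⟨hi1, h2.1⟩
      rw [if_neg hi1] at hi
      rw [h2.1, neg_add_cancel, fraction_zero, if_pos rfl] at hj
      rw [h2.2, neg_add_cancel, fraction_zero, if_pos rfl] at hk
      simp only [antichainSize, antichainPotential, hi, h2.1, h2.2, hi1, false_and, if_true,
        if_false]
      push_cast
      linear_combination -hj - hk
    · simp only [antichainSize, antichainPotential, hi, hj, hk, if_neg h1]
      split_ifs <;> push_cast <;> ring
  · have hk := fraction_add_one k
    simp only [step, peak_mem_peaks, peak_notMem_noValleys, if_true, if_false]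
    split_ifs with h
    · rw [h, neg_add_cancel, fraction_zero, if_pos rfl] at hk
      simp only [antichainSize, antichainPotential, h, fraction_zero, if_true]
      push_cast
      linear_combination -hk
    · simp only [antichainSize, antichainPotential, hk, fraction_zero, if_neg h]
      push_cast
      ring
  · have hi := fraction_add_one i
    simp only [step, noValley_notMem_peaks, noValley_mem_noValleys, if_true, if_false]
    simp only [antichainSize, antichainPotential, hi, fraction_zero]
    split_ifs <;> push_cast <;> ring

/-! ### Counting the orbits -/

/-- The numbers that occur in the orbit count: `A = a / gcd a b`, `B = b / gcd a b`, and a solution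
of `m A = q B + 1` with `0 < q ≤ A`. -/
structure BezoutData (a b A B m q : ℕ) : Prop where
  left_eq : a = a.gcd b * A
  right_eq : b = a.gcd b * B
  eq : m * A = q * B + 1
  q_pos : 0 < q
  q_le : q ≤ A

/-- If the pauses in `peak` on an orbit begin with `peak (b * d)`, then those in `noValley` begin
with `noValley (b * partner A q d)`. -/
def partner (A q d : ℕ) : ℕ := if d ≤ q then q - d else q + A - d

section Count

variable {A B m q : ℕ} (h : BezoutData a b A B m q)
include h

omit [NeZero b] in
theorem BezoutData.lcm_eq : a.lcm b = b * A := by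
  have hg : 0 < a.gcd b := Nat.gcd_pos_of_pos_left b (Nat.pos_of_ne_zero (NeZero.ne a))
  have h1 := Nat.gcd_mul_lcm a b
  nth_rw 3 [h.left_eq] at h1
  rw [mul_assoc] at h1
  rw [Nat.eq_of_mul_eq_mul_left hg h1, mul_comm]

omit [NeZero b] in
theorem BezoutData.left_dvd : a ∣ b * A := h.lcm_eq ▸ Nat.dvd_lcm_left a b

omit [NeZero a] [NeZero b] in
theorem BezoutData.left_dvd_add : a ∣ b * q + a.gcd b := by
  refine ⟨m, ?_⟩
  calc b * q + a.gcd b = a.gcd b * B * q + a.gcd b := by rw [← h.right_eq]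
    _ = a.gcd b * (q * B + 1) := by ring
    _ = a.gcd b * A * m := by rw [← h.eq]; ring
    _ = a * m := by rw [← h.left_eq]

omit [NeZero a] [NeZero b] in
theorem BezoutData.A_pos : 0 < A := h.q_pos.trans_le h.q_le

omit [NeZero a] [NeZero b] in
theorem BezoutData.partner_lt {d : ℕ} (hd : 0 < d) (hd' : d ≤ A) : partner A q d < A := by
  have := h.q_le
  unfold partner
  split_ifs <;> omega

omit [NeZero b] in
theorem BezoutData.left_dvd_partner_add {d : ℕ} (hd' : d ≤ A) :
    a ∣ b * (partner A q d + d) + a.gcd b := by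
  unfold partner
  split_ifs with hdq
  · rw [Nat.sub_add_cancel hdq]
    exact h.left_dvd_add
  · rw [Nat.sub_add_cancel (by omega), mul_add, add_right_comm]
    exact dvd_add h.left_dvd_add h.left_dvd

theorem BezoutData.partner_hyps {d : ℕ} (hd : 0 < d) (hd' : d ≤ A) :
    b * partner A q d < a.lcm b ∧ 0 < b * d ∧ b * d ≤ a.lcm b ∧
      ((b * (partner A q d + d) + a.gcd b : ℕ) : ZMod a) = 0 := by
  have hb : 0 < b := Nat.pos_of_ne_zero (NeZero.ne b)
  rw [h.lcm_eq]
  exact ⟨(Nat.mul_lt_mul_left hb).2 (h.partner_lt hd hd'), Nat.mul_pos hb hd,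
    Nat.mul_le_mul_left b hd', (ZMod.natCast_eq_zero_iff _ _).2 (h.left_dvd_partner_add hd')⟩

omit [NeZero b] in
/-- Division with remainder by the subgroup generated by `b`, which is generated by `gcd a b`. -/
theorem BezoutData.exists_repr (x : ZMod a) :
    ∃ c < A, ∃ n < a.gcd b, ((b * c + n : ℕ) : ZMod a) = x := by
  have hg : 0 < a.gcd b := Nat.gcd_pos_of_pos_left b (Nat.pos_of_ne_zero (NeZero.ne a))
  obtain ⟨A', hA'⟩ := Nat.exists_eq_succ_of_ne_zero h.A_pos.ne'
  have h1 : ((b * q + a.gcd b : ℕ) : ZMod a) = 0 :=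
    (ZMod.natCast_eq_zero_iff _ _).2 h.left_dvd_add
  have h2 : ((b * A : ℕ) : ZMod a) = 0 := (ZMod.natCast_eq_zero_iff _ _).2 h.left_dvd
  have h3 : ((a.gcd b * A : ℕ) : ZMod a) = 0 := by
    rw [← h.left_eq]
    exact ZMod.natCast_self a
  -- `b * q = -g` and `g * (A - 1) = -g` modulo `a`, hence `b * (q * (A - 1)) = g`.
  set t := x.val / a.gcd b
  set N := q * A' * t
  refine ⟨N % A, Nat.mod_lt _ h.A_pos, x.val % a.gcd b, Nat.mod_lt _ hg, ?_⟩
  have h4 : ((b * N : ℕ) : ZMod a) = (b * (N % A) : ℕ) := by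
    conv_lhs => rw [← Nat.div_add_mod N A]
    push_cast at h2 ⊢
    linear_combination (N / A : ℕ) * h2
  have h5 : x = ((a.gcd b * t + x.val % a.gcd b : ℕ) : ZMod a) := by
    rw [Nat.div_add_mod, ZMod.natCast_zmod_val]
  conv_rhs => rw [h5]
  rw [Nat.cast_add, ← h4, Nat.cast_add]
  rw [hA'] at h3
  push_cast [N] at h1 h3 ⊢
  linear_combination (A' * t : ZMod a) * h1 - t * h3

/-- Every orbit with a pause is the orbit of `peak (b * d)` for some `1 ≤ d ≤ A`. -/
theorem BezoutData.exists_orbit_eq {x : FenceState a b} (hx : x ∈ peaks a b ∪ noValleys a b) :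
    ∃ d, 0 < d ∧ d ≤ A ∧ orbitOf (stepPerm a b) x = orbitOf (stepPerm a b) (peak (b * d : ℕ)) := by
  have hq := h.q_le
  have hq' := h.q_pos
  rcases hx with ⟨k, rfl⟩ | ⟨i, rfl⟩
  · obtain ⟨c, hc, n, hn, rfl⟩ := h.exists_repr k
    obtain ⟨d, hd, hd', hdc⟩ : ∃ d, 0 < d ∧ d ≤ A ∧
        ((b * d : ℕ) : ZMod a) = ((b * c : ℕ) : ZMod a) := by
      rcases Nat.eq_zero_or_pos c with rfl | hc0
      · refine ⟨A, h.A_pos, le_rfl, ?_⟩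
        rw [mul_zero, Nat.cast_zero]
        exact (ZMod.natCast_eq_zero_iff _ _).2 h.left_dvd
      · exact ⟨c, hc0, hc.le, rfl⟩
    obtain ⟨h1, h2, h3, h4⟩ := h.partner_hyps hd hd'
    refine ⟨d, hd, hd', orbitOf_eq_of_mem ?_⟩
    rw [peak_mem_orbit_peak_iff h1 h2 h3 h4]
    refine ⟨n, hn, ?_⟩
    rw [Nat.cast_add, hdc, Nat.cast_add]
  · obtain ⟨c, hc, n, hn, rfl⟩ := h.exists_repr i
    obtain ⟨d, hd, hd', rfl⟩ : ∃ d, 0 < d ∧ d ≤ A ∧ partner A q d = c := by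
      unfold partner
      rcases lt_or_ge c q with hcq | hcq
      · exact ⟨q - c, by omega, by omega, by rw [if_pos (by omega)]; omega⟩
      · exact ⟨q + A - c, by omega, by omega, by rw [if_neg (by omega)]; omega⟩
    obtain ⟨h1, h2, h3, h4⟩ := h.partner_hyps hd hd'
    refine ⟨d, hd, hd', orbitOf_eq_of_mem ?_⟩
    rw [noValley_mem_orbit_peak_iff h1 h2 h3 h4]
    exact ⟨n, hn, rfl⟩

theorem BezoutData.orbit_peak_injOn :
    Set.InjOn (fun d : ℕ => orbitOf (stepPerm a b) (peak (b * d : ℕ))) (Set.Icc 1 A) := by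
  -- It suffices to bound `d` by `d'`: otherwise `a` divides `b * (d - d')` with `0 < d - d' < A`.
  have key : ∀ d ∈ Set.Icc 1 A, ∀ d' ∈ Set.Icc 1 A,
      orbitOf (stepPerm a b) (peak (b * d : ℕ)) = orbitOf (stepPerm a b) (peak (b * d' : ℕ)) →
      d ≤ d' := by
    intro d hd d' hd' hdd
    obtain ⟨h1, h2, h3, h4⟩ := h.partner_hyps hd'.1 hd'.2
    have hmem := mem_orbitOf_self (stepPerm a b) (peak (b * d : ℕ))
    rw [hdd, peak_mem_orbit_peak_iff h1 h2 h3 h4] at hmem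
    obtain ⟨n, hn, hn'⟩ := hmem
    by_contra hlt
    have h5 : ((b * (d - d') : ℕ) : ZMod a) = n := by
      rw [Nat.mul_sub, Nat.cast_sub (Nat.mul_le_mul_left b (by omega)), ← hn']
      push_cast
      ring
    have h6 : n = 0 := by
      by_contra hn0
      refine natCast_mul_add_ne_zero (a := a) (b := b) (e := d') (Nat.pos_of_ne_zero hn0) hn
        (A - d) ?_
      rw [hn', ← Nat.cast_add, ← mul_add, Nat.add_sub_cancel' hd.2]
      exact (ZMod.natCast_eq_zero_iff _ _).2 h.left_dvd
    rw [h6, Nat.cast_zero, ZMod.natCast_eq_zero_iff] at h5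
    have h7 := Nat.lcm_dvd h5 (dvd_mul_right b _)
    rw [h.lcm_eq] at h7
    have h8 := Nat.le_of_dvd (by omega) (Nat.dvd_of_mul_dvd_mul_left
      (Nat.pos_of_ne_zero (NeZero.ne b)) h7)
    have := hd'.1
    have := hd.2
    omega
  intro d hd d' hd' hdd
  exact le_antisymm (key d hd d' hd' hdd) (key d' hd' d hd hdd.symm)

theorem BezoutData.ncard_orbit_peak_ne_lcm (ha : 2 ≤ a) {d : ℕ} (hd : 0 < d) (hd' : d ≤ A) :
    (orbitOf (stepPerm a b) (peak (b * d : ℕ))).ncard ≠ a.lcm b := by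
  obtain ⟨h1, h2, h3, h4⟩ := h.partner_hyps hd hd'
  have hg : 0 < a.gcd b := Nat.gcd_pos_of_pos_left b (Nat.pos_of_ne_zero (NeZero.ne a))
  rw [(orbit_peak h1 h2 h3 h4).1]
  intro heq
  rcases (show 1 ≤ a.gcd b from hg).eq_or_lt with hg1 | hg1
  · -- If `a` and `b` are coprime, the size of the orbit is `1` modulo `a`.
    have h5 := h.left_dvd_partner_add hd'
    rw [← hg1] at heq h5
    have h6 := Nat.dvd_lcm_left a b
    rw [← heq, show 2 * (1 - 1) * (a.lcm b + 1) + b * (partner A q d + d) + 2 =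
      b * (partner A q d + d) + 1 + 1 by omega, Nat.dvd_add_right h5] at h6
    have := Nat.le_of_dvd one_pos h6
    omega
  · have : 1 * (a.lcm b + 1) ≤ 2 * (a.gcd b - 1) * (a.lcm b + 1) :=
      Nat.mul_le_mul_right _ (by omega)
    omega

/-- Every orbit either has no pauses, and then size `lcm a b`, or it has `gcd a b` pauses of each
kind, and then another size. -/
theorem BezoutData.ncard_inter (ha : 2 ≤ a) {O : Set (FenceState a b)}
    (hO : O ∈ orbitsOf (stepPerm a b)) :
    (O ∩ peaks a b).ncard = (if O.ncard = a.lcm b then 0 else a.gcd b) ∧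
      (O ∩ noValleys a b).ncard = (if O.ncard = a.lcm b then 0 else a.gcd b) := by
  by_cases hdisj : Disjoint O (peaks a b ∪ noValleys a b)
  · have hsize := ncard_orbit_of_disjoint hO hdisj
    rw [Set.disjoint_union_right] at hdisj
    rw [if_pos hsize, hdisj.1.inter_eq, hdisj.2.inter_eq, Set.ncard_empty]
    exact ⟨rfl, rfl⟩
  · rw [Set.not_disjoint_iff] at hdisj
    obtain ⟨x, hxO, hx⟩ := hdisj
    obtain ⟨y, rfl⟩ := mem_orbitsOf.1 hO
    obtain ⟨d, hd, hd', hOd⟩ := h.exists_orbit_eq hx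
    obtain ⟨h1, h2, h3, h4⟩ := h.partner_hyps hd hd'
    rw [← orbitOf_eq_of_mem hxO, hOd, if_neg (h.ncard_orbit_peak_ne_lcm ha hd hd'),
      ncard_orbit_peak_inter_peaks h1 h2 h3 h4, ncard_orbit_peak_inter_noValleys h1 h2 h3 h4]
    exact ⟨rfl, rfl⟩

theorem BezoutData.isMesic (ha : 2 ≤ a) :
    IsMesic (stepPerm a b) idealSize ((2 * a + b - 1) / 2) := by
  have : Finite (FenceState a b) := Finite.of_equiv _ (equivIdeal a b).symm
  intro O hO
  have hne : (O.ncard : ℚ) ≠ 0 := by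
    obtain ⟨x, rfl⟩ := mem_orbitsOf.1 hO
    exact Nat.cast_ne_zero.2 (Set.ncard_ne_zero_of_mem (mem_orbitOf_self _ x))
  rw [div_eq_iff hne, statTotal_eq_of_coboundary idealSize_eq hO, (h.ncard_inter ha hO).1,
    (h.ncard_inter ha hO).2]
  ring

theorem BezoutData.isOrbomesic (ha : 2 ≤ a) : IsOrbomesic (stepPerm a b) antichainSize := by
  have : Finite (FenceState a b) := Finite.of_equiv _ (equivIdeal a b).symm
  intro O₁ h₁ O₂ h₂ hcard
  have key : (statTotal antichainSize O₁ : ℚ) = statTotal antichainSize O₂ := by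
    rw [statTotal_eq_of_coboundary antichainSize_eq h₁,
      statTotal_eq_of_coboundary antichainSize_eq h₂,
      (h.ncard_inter ha h₁).1, (h.ncard_inter ha h₁).2, (h.ncard_inter ha h₂).1,
      (h.ncard_inter ha h₂).2, hcard]
  exact_mod_cast key

/-- The orbits of `peak (b * d)` are counted by `d`; their size depends only on whether `d ≤ q`. The
number of the other orbits, all of size `lcm a b`, follows from the total number of ideals. -/
theorem BezoutData.orbitsPartitionByLength (ha : 2 ≤ a) :
    OrbitsPartitionByLength (stepPerm a b)
      ((A : ℚ) * ((a.gcd b : ℚ) - 1) ^ 2) (a.lcm b : ℚ)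
      (((A : ℚ) * m - 1) / B) ((a : ℚ) * (2 * b - 2 * B + m) + a.gcd b)
      (((A : ℚ) * ((B : ℚ) - m) + 1) / B) ((a : ℚ) * (2 * b - B + m) + a.gcd b) := by
  have : Finite (FenceState a b) := Finite.of_equiv _ (equivIdeal a b).symm
  have hg : 0 < a.gcd b := Nat.gcd_pos_of_pos_left b (Nat.pos_of_ne_zero (NeZero.ne a))
  have hb : 0 < b := Nat.pos_of_ne_zero (NeZero.ne b)
  have hB : (B : ℚ) ≠ 0 := by
    rintro hB
    rw [Nat.cast_eq_zero] at hB
    have := h.right_eq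
    rw [hB, mul_zero] at this
    omega
  have hA0 : (A : ℚ) ≠ 0 := Nat.cast_ne_zero.2 h.A_pos.ne'
  have hb0 : (b : ℚ) ≠ 0 := Nat.cast_ne_zero.2 hb.ne'
  have hlq : (a.lcm b : ℚ) = b * A := by rw [h.lcm_eq, Nat.cast_mul]
  have haq : (a : ℚ) = a.gcd b * A := by exact_mod_cast h.left_eq
  have hbq : (b : ℚ) = a.gcd b * B := by exact_mod_cast h.right_eq
  have heq : (m : ℚ) * A = q * B + 1 := by exact_mod_cast h.eq
  set F : ℕ → Set (FenceState a b) := fun d => orbitOf (stepPerm a b) (peak (b * d : ℕ)) with hF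
  set S : Set (Set (FenceState a b)) :=
    {O | O ∈ orbitsOf (stepPerm a b) ∧ Disjoint O (peaks a b ∪ noValleys a b)} with hSdef
  set sM := 2 * (a.gcd b - 1) * (a.lcm b + 1) + b * q + 2 with hsM
  set sL := 2 * (a.gcd b - 1) * (a.lcm b + 1) + b * (q + A) + 2 with hsL
  have hU : S ∪ F '' Set.Icc 1 q ∪ F '' Set.Ioc q A = orbitsOf (stepPerm a b) := by
    ext O
    constructor
    · rintro ((hO | ⟨d, -, rfl⟩) | ⟨d, -, rfl⟩)
      · exact hO.1
      · exact ⟨_, rfl⟩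
      · exact ⟨_, rfl⟩
    · intro hO
      by_cases hdisj : Disjoint O (peaks a b ∪ noValleys a b)
      · exact Or.inl (Or.inl ⟨hO, hdisj⟩)
      · rw [Set.not_disjoint_iff] at hdisj
        obtain ⟨x, hxO, hx⟩ := hdisj
        obtain ⟨y, rfl⟩ := mem_orbitsOf.1 hO
        obtain ⟨d, hd, hd', hOd⟩ := h.exists_orbit_eq hx
        rw [← orbitOf_eq_of_mem hxO, hOd]
        rcases le_or_gt d q with hdq | hdq
        · exact Or.inl (Or.inr ⟨d, ⟨hd, hdq⟩, rfl⟩)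
        · exact Or.inr ⟨d, ⟨hdq, hd'⟩, rfl⟩
  have hS : ∀ O ∈ S, O.ncard = a.lcm b := fun O hO => ncard_orbit_of_disjoint hO.1 hO.2
  have hM : ∀ O ∈ F '' Set.Icc 1 q, O.ncard = sM := by
    rintro _ ⟨d, hd, rfl⟩
    obtain ⟨h1, h2, h3, h4⟩ := h.partner_hyps hd.1 (hd.2.trans h.q_le)
    rw [hF]
    simp only
    rw [(orbit_peak h1 h2 h3 h4).1, hsM]
    unfold partner
    rw [if_pos hd.2, Nat.sub_add_cancel hd.2]
  have hL : ∀ O ∈ F '' Set.Ioc q A, O.ncard = sL := by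
    rintro _ ⟨d, hd, rfl⟩
    have hd1 := hd.1
    have hd2 := hd.2
    obtain ⟨h1, h2, h3, h4⟩ := h.partner_hyps (by omega : 0 < d) hd.2
    rw [hF]
    simp only
    rw [(orbit_peak h1 h2 h3 h4).1, hsL]
    unfold partner
    rw [if_neg (by omega), Nat.sub_add_cancel (by omega)]
  have hne : ∀ d, 0 < d → d ≤ A → (F d).ncard ≠ a.lcm b := fun d hd hd' =>
    h.ncard_orbit_peak_ne_lcm ha hd hd'
  have cM : (F '' Set.Icc 1 q).ncard = q := by
    rw [Set.InjOn.ncard_image (h.orbit_peak_injOn.mono (Set.Icc_subset_Icc_right h.q_le)),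
      ← Finset.coe_Icc, Set.ncard_coe_finset, Nat.card_Icc, Nat.add_sub_cancel]
  have cL : (F '' Set.Ioc q A).ncard = A - q := by
    rw [Set.InjOn.ncard_image (h.orbit_peak_injOn.mono (Set.Ioc_subset_Icc_self.trans
        (Set.Icc_subset_Icc_left h.q_pos))),
      ← Finset.coe_Ioc, Set.ncard_coe_finset, Nat.card_Ioc]
  have hdisj1 : Disjoint S (F '' Set.Icc 1 q) := by
    rw [Set.disjoint_left]
    rintro _ hO ⟨d, hd, rfl⟩
    exact hne d hd.1 (hd.2.trans h.q_le) (hS _ hO)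
  have hdisj2 : Disjoint (S ∪ F '' Set.Icc 1 q) (F '' Set.Ioc q A) := by
    rw [Set.disjoint_left]
    rintro _ (hO | hO) ⟨d, hd, rfl⟩
    · exact hne d (h.q_pos.trans hd.1) hd.2 (hS _ hO)
    · have h1 := hM _ hO
      rw [hL _ ⟨d, hd, rfl⟩, hsM, hsL, mul_add b q A] at h1
      have := Nat.mul_pos hb h.A_pos
      omega
  have total := finsum_ncard_orbitsOf (stepPerm a b)
  rw [← hU, finsum_mem_union hdisj2 (Set.toFinite _) (Set.toFinite _),
    finsum_mem_union hdisj1 (Set.toFinite _) (Set.toFinite _), finsum_ncard_eq_mul hS,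
    finsum_ncard_eq_mul hM, finsum_ncard_eq_mul hL, cM, cL, natCard_fenceState] at total
  have sMq : (sM : ℚ) = (a : ℚ) * (2 * b - 2 * B + m) + a.gcd b := by
    rw [hsM]
    push_cast [Nat.cast_sub (show 1 ≤ a.gcd b from hg)]
    rw [hlq, haq, hbq]
    linear_combination (-(a.gcd b : ℚ)) * heq
  have sLq : (sL : ℚ) = (a : ℚ) * (2 * b - B + m) + a.gcd b := by
    rw [hsL]
    push_cast [Nat.cast_sub (show 1 ≤ a.gcd b from hg)]
    rw [hlq, haq, hbq]
    linear_combination (-(a.gcd b : ℚ)) * heq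
  have totalq : (S.ncard : ℚ) * (b * A) + q * sM + (A - q) * sL = a * b * a + 2 * a := by
    rw [← hlq, ← Nat.cast_sub h.q_le]
    exact_mod_cast total
  -- A common size of the first two classes is excluded by the orbit of `peak b`.
  have sSM : (a.lcm b : ℚ) ≠ sM := by
    have h1 := hne 1 one_pos h.A_pos
    rw [hM _ ⟨1, ⟨le_rfl, h.q_pos⟩, rfl⟩] at h1
    exact_mod_cast h1.symm
  have sSL : (a.lcm b : ℚ) ≠ sL := by
    have : a.lcm b < sL := by
      rw [hsL, mul_add b q A, ← h.lcm_eq]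
      omega
    exact_mod_cast this.ne
  have sML : (sM : ℚ) ≠ sL := by
    have := Nat.mul_pos hb h.A_pos
    rw [hsM, hsL, mul_add b q A]
    exact_mod_cast (by omega)
  rw [← sMq, ← sLq]
  refine OrbitsPartitionByLength.of_sizes hU sSM sSL sML (fun O hO => by rw [hS O hO])
    (fun O hO => by rw [hM O hO]) (fun O hO => by rw [hL O hO]) ?_ ?_ ?_
  · rw [sMq, sLq, haq, hbq] at totalq
    rw [hbq] at hb0
    refine mul_right_cancel₀ (mul_ne_zero hb0 hA0) ?_
    linear_combination totalq - A * a.gcd b * heq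
  · rw [cM, eq_div_iff hB]
    linear_combination -heq
  · rw [cL, Nat.cast_sub h.q_le, eq_div_iff hB]
    linear_combination heq

end Count

/-- The least solution of the Bézout equation has the bound that the orbit count needs. -/
theorem exists_isLeast_bezoutData (a b : ℕ) [NeZero a] [NeZero b] :
    ∃ m q, IsLeast {k : ℕ | 0 < k ∧ ∃ q : ℕ, 0 < q ∧
        k * (a / a.gcd b) = q * (b / a.gcd b) + 1} m ∧
      BezoutData a b (a / a.gcd b) (b / a.gcd b) m q := by
  have ha : 0 < a := Nat.pos_of_ne_zero (NeZero.ne a)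
  have hb : 0 < b := Nat.pos_of_ne_zero (NeZero.ne b)
  have hg : 0 < a.gcd b := Nat.gcd_pos_of_pos_left b ha
  have hA : a = a.gcd b * (a / a.gcd b) := (Nat.mul_div_cancel' (Nat.gcd_dvd_left a b)).symm
  have hB : b = a.gcd b * (b / a.gcd b) := (Nat.mul_div_cancel' (Nat.gcd_dvd_right a b)).symm
  have hAB : Nat.Coprime (a / a.gcd b) (b / a.gcd b) := Nat.coprime_div_gcd_div_gcd hg
  have hA0 : 0 < a / a.gcd b := Nat.div_pos (Nat.gcd_le_left b ha) hg
  have hB0 : 0 < b / a.gcd b := Nat.div_pos (Nat.gcd_le_right a hb) hg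
  generalize a / a.gcd b = A at *
  generalize b / a.gcd b = B at *
  have hex : ∃ k, 0 < k ∧ ∃ q, 0 < q ∧ k * A = q * B + 1 := by
    obtain ⟨x, hxA, hxB⟩ := Nat.chineseRemainder hAB 0 1
    obtain ⟨c, hc⟩ := (Nat.modEq_zero_iff_dvd.1 hxA)
    -- Adding `2 A B` makes the quotient by `B` positive.
    have h1 : 1 ≡ x + 2 * A * B [MOD B] := by
      have : x + 2 * A * B ≡ 1 + 0 [MOD B] :=
        hxB.add (Nat.modEq_zero_iff_dvd.2 (dvd_mul_left B _))
      exact this.symm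
    have h2 : 0 < A * B := Nat.mul_pos hA0 hB0
    obtain ⟨q, hq⟩ := (Nat.modEq_iff_dvd' (by rw [mul_assoc]; omega)).1 h1
    refine ⟨c + 2 * B, by omega, q, Nat.pos_of_ne_zero fun h0 => ?_, ?_⟩
    · rw [h0, mul_zero, mul_assoc] at hq
      omega
    · have h3 : (c + 2 * B) * A = x + 2 * A * B := by
        rw [hc]
        ring
      rw [h3, mul_comm q B, ← hq, mul_assoc]
      omega
  classical
  obtain ⟨hm0, q, hq0, hq⟩ := Nat.find_spec hex
  refine ⟨Nat.find hex, q, ⟨Nat.find_spec hex, fun k hk => Nat.find_min' hex hk⟩,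
    hA, hB, hq, hq0, not_lt.1 fun hlt => ?_⟩
  -- If `A < q`, then `(m - B, q - A)` is a smaller solution.
  have hBm : B < Nat.find hex := by
    by_contra hle
    have h1 : Nat.find hex * A ≤ B * A := Nat.mul_le_mul_right A (not_lt.1 hle)
    have h2 : A * B ≤ q * B := Nat.mul_le_mul_right B hlt.le
    rw [mul_comm B A] at h1
    omega
  refine Nat.find_min hex (m := Nat.find hex - B) (by omega) ⟨by omega, q - A, by omega, ?_⟩
  rw [Nat.sub_mul, Nat.sub_mul, hq, mul_comm B A]
  have h2 : A * B ≤ q * B := Nat.mul_le_mul_right B hlt.le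
  omega

end FenceState

theorem mainTheorem5 (a b : ℕ) (ha : 2 ≤ a) (hb : 1 ≤ b)
    (g abar bbar l : ℕ) (hg : g = Nat.gcd a b) (habar : abar = a / g) (hbbar : bbar = b / g)
    (hl : l = Nat.lcm a b) :
    ∃ m : ℕ, IsLeast {k : ℕ | 0 < k ∧ ∃ q : ℕ, 0 < q ∧ k * abar = q * bbar + 1} m ∧
      OrbitsPartitionByLength (rowmotion (Fence [a, b, a]))
        ((abar : ℚ) * ((g : ℚ) - 1) ^ 2) (l : ℚ)
        (((abar : ℚ) * m - 1) / bbar) ((a : ℚ) * (2 * b - 2 * bbar + m) + g)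
        (((abar : ℚ) * ((bbar : ℚ) - m) + 1) / bbar) ((a : ℚ) * (2 * b - bbar + m) + g) ∧
      OrbitsPartitionByLength (idealRowmotion (Fence [a, b, a]))
        ((abar : ℚ) * ((g : ℚ) - 1) ^ 2) (l : ℚ)
        (((abar : ℚ) * m - 1) / bbar) ((a : ℚ) * (2 * b - 2 * bbar + m) + g)
        (((abar : ℚ) * ((bbar : ℚ) - m) + 1) / bbar) ((a : ℚ) * (2 * b - bbar + m) + g) ∧
      IsOrbomesic (rowmotion (Fence [a, b, a])) antichainCard ∧
      (Nat.card (Fence [a, b, a]) : ℚ) = 2 * a + b - 1 ∧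
      IsMesic (idealRowmotion (Fence [a, b, a])) idealCard
        ((Nat.card (Fence [a, b, a]) : ℚ) / 2) := by
  have : NeZero a := ⟨by omega⟩
  have : NeZero b := ⟨by omega⟩
  subst hg habar hbbar hl
  obtain ⟨m, q, hm, h⟩ := FenceState.exists_isLeast_bezoutData a b
  have hfin : Finite (FenceState a b) :=
    Finite.of_equiv _ (FenceState.equivIdeal a b).symm
  let e := FenceState.equivIdeal a b
  -- This bijection also carries rowmotion on ideals to rowmotion on antichains, since the two are
  -- the products, in the two orders, of the same two bijections.
  let e' := e.trans ((idealCompl (Fence [a, b, a])).trans (upperEquivAntichain _))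
  have he : ∀ s, e (FenceState.stepPerm a b s) = idealRowmotion _ (e s) := fun s =>
    e.apply_symm_apply _
  have he' : ∀ s, e' (FenceState.stepPerm a b s) = rowmotion _ (e' s) := fun s =>
    congrArg ((idealCompl _).trans (upperEquivAntichain _)) (he s)
  have hcard : (Nat.card (Fence [a, b, a]) : ℚ) = 2 * a + b - 1 := by
    rw [FenceState.natCard_fence (by omega), Nat.cast_sub (by omega)]
    push_cast
    ring
  refine ⟨m, hm, (h.orbitsPartitionByLength ha).of_semiconj e' he',
    (h.orbitsPartitionByLength ha).of_semiconj e he, ?_, hcard, ?_⟩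
  · refine IsOrbomesic.of_semiconj e' he' ?_
    rw [show (fun s => antichainCard (e' s)) = FenceState.antichainSize from
      funext FenceState.antichainCard_minimal_compl]
    exact h.isOrbomesic ha
  · refine IsMesic.of_semiconj e he ?_
    rw [show (fun s => idealCard (e s)) = FenceState.idealSize from
      funext FenceState.idealCard_toIdeal, hcard]
    exact h.isMesic ha
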